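/- **Lemma (nonlinear remainder estimate).** Let $\Omega=(\mathbb R/2\pi\mathbb Z)^d$, $\sigma>0$, $\delta>0$, $V\in C^2(\Omega)$, and let $W\in W^{2,\infty}(\Omega)$ be even. Let $\bar\mu$ be a stationary state, i.e. a probability density on $\Omega$ with $$\bar\mu=\frac1Z\exp\Bigl(-\frac{V+W*\bar\mu}{\sigma}\Bigr)\ \text{a.e.},\qquad Z=\int_\Omega \exp\Bigl(-\frac{V+W*\bar\mu}{\sigma}\Bigr)dx ,$$ where $(f*g)(x)=\int_\Omega f(x-x')g(x')\,dx'$. For $u\in L^2(\Omega)$ let $\mathcal W(u)=\nabla\cdot(u\,\nabla W*u)\in[H^1(\Omega)]'$, that is, $\langle \mathcal W(u),\varphi\rangle=-\int_\Omega u\,(\nabla W*u)\cdot\nabla\varphi\,dx$ for $\varphi\in H^1(\Omega)$. Let $\mathcal U y=y/\sqrt{\bar\mu}$ and $\mathcal U^{-1}y=\sqrt{\bar\mu}\,y$, where $\mathcal U$ acts on $G\in[H^1(\Omega)]'$ by $\langle\mathcal U G,\varphi\rangle=\langle G,\varphi/\sqrt{\bar\mu}\rangle$. For a function $y$ of $t\in(0,\infty)$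 and $x\in\Omega$ set $$\hat{\mathcal W}^\delta(y)(t)=e^{-2\delta t}\,\mathcal U\,\mathcal W\bigl(\mathcal U^{-1}y(t)\bigr).$$ Let $L^2_0(\Omega)$ be either $\{f\in L^2(\Omega):\int_\Omega f\,dx=0\}$ or $\{f\in L^2(\Omega):\int_\Omega f\sqrt{\bar\mu}\,dx=0\}$ (the image under $\mathcal U$ of the functions of zero mean), and let $$W(Q_\infty)=L^2\bigl(0,\infty;H^1(\Omega)\cap L^2_0(\Omega)\bigr)\cap H^1\bigl(0,\infty;[H^1(\Omega)\cap L^2_0(\Omega)]'\bigr),$$ $$\|y\|_{W(Q_\infty)}^2=\int_0^\infty\|y(t)\|_{H^1}^2+\|y'(t)\|_{[H^1\cap L^2_0]'}^2\,dt,$$ where $L^2(\Omega)$ is the pivot space, i.e. $f\in H^1\cap L^2_0$ is identified with the functional $\varphi\mapsto\int_\Omega f\varphi\,dx$ in $[H^1\cap L^2_0]'$. Then, for either choice of $L^2_0(\Omega)$, $\hat{\mathcal W}^\delta$ is well defined as a map from $W(Q_\infty)$ to $L^2(0,\infty;[H^1(\Omega)]')$, and there exists $C>0$ such that for all $y,z\in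 W(Q_\infty)$ $$\|\hat{\mathcal W}^\delta(y)-\hat{\mathcal W}^\delta(z)\|_{L^2(0,\infty;[H^1(\Omega)]')}\le C\bigl(\|y\|_{W(Q_\infty)}+\|z\|_{W(Q_\infty)}\bigr)\|y-z\|_{W(Q_\infty)}.$$ -/

import Mathlib

open MeasureTheory Set
open scoped ENNReal RealInnerProductSpace

noncomputable section

namespace McKeanVlasov

instance instFactTwoPiPos : Fact ((0 : ℝ) < 2 * Real.pi) := ⟨Real.two_pi_pos⟩

/-- The torus `Ω = (ℝ / 2πℤ)^d`; its `volume` is Lebesgue measure, of total mass `(2π)^d`. -/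
abbrev Torus (d : ℕ) : Type := Fin d → AddCircle (2 * Real.pi)

/-- `f` is of class `C¹` on the torus, with classical partial derivatives `Df i`. -/
structure HasC1Grad {d : ℕ} (f : Torus d → ℝ) (Df : Fin d → Torus d → ℝ) : Prop where
  continuous : Continuous f
  continuous_grad : ∀ i, Continuous (Df i)
  hasDerivAt : ∀ (i : Fin d) (x : Torus d),
    HasDerivAt (fun s : ℝ => f (x + Pi.single i (s : AddCircle (2 * Real.pi)))) (Df i x) 0

/-- `f ∈ C²(Ω)`. -/
def IsC2 {d : ℕ} (f : Torus d → ℝ) : Prop :=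
  ∃ Df : Fin d → Torus d → ℝ, HasC1Grad f Df ∧ ∀ i, ∃ D2f, HasC1Grad (Df i) D2f

/-- `g` is the weak partial derivative `∂ᵢ f` on the torus (tested against `C¹` functions; there is
no boundary, so no support condition). Used for integrable `f` and `g` only. -/
def HasWeakPartial {d : ℕ} (i : Fin d) (f g : Torus d → ℝ) : Prop :=
  ∀ (φ : Torus d → ℝ) (Dφ : Fin d → Torus d → ℝ), HasC1Grad φ Dφ →
    ∫ x, f x * Dφ i x = -∫ x, g x * φ x

/-- `f ∈ W^{1,∞}(Ω)` with weak gradient `Df`. -/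
structure HasGradW1Infty {d : ℕ} (f : Torus d → ℝ) (Df : Fin d → Torus d → ℝ) : Prop where
  memLp : MemLp f ∞ volume
  memLp_grad : ∀ i, MemLp (Df i) ∞ volume
  weak : ∀ i, HasWeakPartial i f (Df i)

/-- `f ∈ W^{2,∞}(Ω)` with weak gradient `Df`. -/
structure HasGradW2Infty {d : ℕ} (f : Torus d → ℝ) (Df : Fin d → Torus d → ℝ) : Prop where
  first : HasGradW1Infty f Df
  second : ∀ i, ∃ D2f, HasGradW1Infty (Df i) D2f

/-- Periodic convolution `(k * u)(x) = ∫_Ω k(x - x') u(x') dx'`. -/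
def conv {d : ℕ} (k u : Torus d → ℝ) (x : Torus d) : ℝ := ∫ x', k (x - x') * u x'

/-- `v[μ] = V + W * μ`. -/
def meanFieldPotential {d : ℕ} (V W μ : Torus d → ℝ) (x : Torus d) : ℝ := V x + conv W μ x

/-- `μ` is a stationary state: a probability density satisfying the self-consistency relation
`μ = Z⁻¹ exp (-v[μ] / σ)`, with `Z = ∫_Ω exp (-v[μ] / σ)`. -/
structure IsStationaryState {d : ℕ} (σ : ℝ) (V W μ : Torus d → ℝ) : Prop where
  integrable : Integrable μ volume
  nonneg : ∀ᵐ x, 0 ≤ μ x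
  integral_eq_one : ∫ x, μ x = 1
  self_consistent : ∀ᵐ x, μ x =
    (∫ x', Real.exp (-(meanFieldPotential V W μ x') / σ))⁻¹ *
      Real.exp (-(meanFieldPotential V W μ x) / σ)

/-- `L²(Ω)`. -/
abbrev L2 (d : ℕ) : Type := Lp ℝ 2 (volume : Measure (Torus d))

lemma integrable_mul_continuous {d : ℕ} {φ : Torus d → ℝ} (hφ : Continuous φ) (f : L2 d) :
    Integrable (fun x => f x * φ x) volume := by
  obtain ⟨C, hC⟩ := isCompact_univ.exists_bound_of_continuousOn hφ.continuousOn
  have hf : Integrable (f : Torus d → ℝ) volume := (Lp.memLp f).integrable (by norm_num)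
  exact hf.mul_bdd (c := C) hφ.aestronglyMeasurable
    (Filter.Eventually.of_forall fun x => hC x (mem_univ x))

/-- The space of all pairs `(f, ∇f)` with `f ∈ L²(Ω)` and weak gradient `∇f ∈ L²(Ω)^d`, with the norm
`‖f‖²_{H¹} = ‖f‖²_{L²} + ∑ i, ‖∂ᵢ f‖²_{L²}`. -/
def h1Submodule (d : ℕ) : Submodule ℝ (WithLp 2 (L2 d × PiLp 2 (fun _ : Fin d => L2 d))) where
  carrier := {p | ∀ i, HasWeakPartial i (p.fst : Torus d → ℝ) (p.snd i : Torus d → ℝ)}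
  zero_mem' := by
    intro i φ Dφ _
    have h : ∀ ψ : Torus d → ℝ, ∫ x, ((0 : L2 d) : Torus d → ℝ) x * ψ x = 0 := fun ψ => by
      rw [integral_congr_ae (g := fun _ => (0 : ℝ)), integral_zero]
      filter_upwards [Lp.coeFn_zero ℝ 2 (volume : Measure (Torus d))] with x hx
      simp only [hx, Pi.zero_apply, zero_mul]
    have h1 := h (Dφ i)
    have h2 := h φ
    simp only [WithLp.zero_fst, WithLp.zero_snd, PiLp.zero_apply]
    rw [h1, h2, neg_zero]
  add_mem' := by
    intro p q hp hq i φ Dφ hφ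
    have h : ∀ (f g : L2 d) (ψ : Torus d → ℝ), Continuous ψ →
        ∫ x, ((f + g : L2 d) : Torus d → ℝ) x * ψ x = (∫ x, f x * ψ x) + ∫ x, g x * ψ x := by
      intro f g ψ hψ
      rw [← integral_add (integrable_mul_continuous hψ f) (integrable_mul_continuous hψ g)]
      refine integral_congr_ae ?_
      filter_upwards [Lp.coeFn_add f g] with x hx
      simp only [hx, Pi.add_apply, add_mul]
    have h1 := h p.fst q.fst (Dφ i) (hφ.continuous_grad i)
    have h2 := h (p.snd i) (q.snd i) φ hφ.continuous
    simp only [WithLp.add_fst, WithLp.add_snd, PiLp.add_apply]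
    rw [h1, h2, hp i φ Dφ hφ, hq i φ Dφ hφ]
    ring
  smul_mem' := by
    intro c p hp i φ Dφ hφ
    have h : ∀ (f : L2 d) (ψ : Torus d → ℝ),
        ∫ x, ((c • f : L2 d) : Torus d → ℝ) x * ψ x = c * ∫ x, f x * ψ x := by
      intro f ψ
      rw [← integral_const_mul]
      refine integral_congr_ae ?_
      filter_upwards [Lp.coeFn_smul c f] with x hx
      simp only [hx, Pi.smul_apply, smul_eq_mul, mul_assoc]
    have h1 := h p.fst (Dφ i)
    have h2 := h (p.snd i) φ
    simp only [WithLp.smul_fst, WithLp.smul_snd, PiLp.smul_apply]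
    rw [h1, h2, hp i φ Dφ hφ]
    ring

/-- The Sobolev space `H¹(Ω)`. -/
def H1 (d : ℕ) : Type := h1Submodule d

instance H1.instNormedAddCommGroup (d : ℕ) : NormedAddCommGroup (H1 d) :=
  inferInstanceAs (NormedAddCommGroup (h1Submodule d))

instance H1.instInnerProductSpace (d : ℕ) : InnerProductSpace ℝ (H1 d) :=
  inferInstanceAs (InnerProductSpace ℝ (h1Submodule d))

/-- The underlying function of an element of `H¹(Ω)`. -/
def H1.toL2 (d : ℕ) : H1 d →L[ℝ] L2 d :=
  (WithLp.fstL 2 ℝ (L2 d) (PiLp 2 (fun _ : Fin d => L2 d))).comp (h1Submodule d).subtypeL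

/-- The weak partial derivative `∂ᵢ φ` of an element of `H¹(Ω)`. -/
def H1.partial {d : ℕ} (i : Fin d) (φ : H1 d) : L2 d := φ.1.snd i

/-- `[H¹(Ω)]'`. -/
abbrev H1Dual (d : ℕ) : Type := StrongDual ℝ (H1 d)

/-- The subspace `{f ∈ H¹(Ω) : ∫_Ω f w = 0}` of `H¹(Ω)`. -/
def h10Submodule {d : ℕ} (w : L2 d) : Submodule ℝ (H1 d) :=
  (ℝ ∙ w)ᗮ.comap (H1.toL2 d : H1 d →ₗ[ℝ] L2 d)

/-- `H¹(Ω) ∩ L²₀(Ω)` with the norm of `H¹(Ω)`, where `L²₀(Ω) = {f ∈ L²(Ω) : ∫_Ω f w = 0}`. For `w = 1`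
these are the functions of zero mean; for `w = √μ` they are the images `f = u / √μ` of the functions
`u` of zero mean. -/
def H10 {d : ℕ} (w : L2 d) : Type := h10Submodule w

instance H10.instNormedAddCommGroup {d : ℕ} (w : L2 d) : NormedAddCommGroup (H10 w) :=
  inferInstanceAs (NormedAddCommGroup (h10Submodule w))

instance H10.instInnerProductSpace {d : ℕ} (w : L2 d) : InnerProductSpace ℝ (H10 w) :=
  inferInstanceAs (InnerProductSpace ℝ (h10Submodule w))

/-- The underlying function of an element of `H¹(Ω) ∩ L²₀(Ω)`. -/
def H10.toL2 {d : ℕ} (w : L2 d) : H10 w →L[ℝ] L2 d := (H1.toL2 d).comp (h10Submodule w).subtypeL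

/-- `[H¹(Ω) ∩ L²₀(Ω)]'`. -/
abbrev H10Dual {d : ℕ} (w : L2 d) : Type := StrongDual ℝ (H10 w)

/-- The embedding of `H¹(Ω) ∩ L²₀(Ω)` into its dual with `L²(Ω)` as pivot space:
`f ↦ (φ ↦ ∫_Ω f φ)`. -/
def pivot {d : ℕ} (w : L2 d) : H10 w →L[ℝ] H10Dual w :=
  (ContinuousLinearMap.precomp ℝ (H10.toL2 w)).comp ((innerSL ℝ).comp (H10.toL2 w))

/-- Lebesgue measure on the time interval `(0, ∞)`. -/
abbrev timeMeasure : Measure ℝ := volume.restrict (Ioi 0)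

/-- `φ ∈ C_c¹(0, ∞)`. -/
structure IsTimeTest (φ : ℝ → ℝ) : Prop where
  contDiff : ContDiff ℝ 1 φ
  hasCompactSupport : HasCompactSupport φ
  tsupport_subset : tsupport φ ⊆ Ioi 0

lemma integrable_test_smul {E : Type*} [NormedAddCommGroup E] [NormedSpace ℝ E]
    {φ : ℝ → ℝ} (hφ : Continuous φ) (hc : HasCompactSupport φ) (f : Lp E 2 timeMeasure) :
    Integrable (fun t => φ t • f t) timeMeasure := by
  have h1 : MemLp φ 2 timeMeasure := (hφ.memLp_of_hasCompactSupport hc (μ := volume)).restrict _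
  exact memLp_one_iff_integrable.1 ((Lp.memLp f).smul h1)

/-- `L²(0,∞; X) ∩ H¹(0,∞; Y)` for an embedding `ι : X → Y`, realised as the space of all pairs `(y, y')`
with `y ∈ L²(0,∞; X)` and weak time derivative `y' ∈ L²(0,∞; Y)`. The norm is
`‖y‖² = ∫₀^∞ ‖y(t)‖²_X + ‖y'(t)‖²_Y dt`. -/
def SobolevTime {X Y : Type*} [NormedAddCommGroup X] [NormedSpace ℝ X] [NormedAddCommGroup Y]
    [NormedSpace ℝ Y] (ι : X →L[ℝ] Y) :
    Submodule ℝ (WithLp 2 (Lp X 2 timeMeasure × Lp Y 2 timeMeasure)) where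
  carrier := {p | ∀ φ : ℝ → ℝ, IsTimeTest φ →
    ∫ t, deriv φ t • ι (p.fst t) ∂timeMeasure = -∫ t, φ t • p.snd t ∂timeMeasure}
  zero_mem' := by
    intro φ _
    have h1 : ∫ t, deriv φ t • ι ((0 : Lp X 2 timeMeasure) t) ∂timeMeasure = 0 := by
      rw [integral_congr_ae (g := fun _ => 0), integral_zero]
      filter_upwards [Lp.coeFn_zero X 2 timeMeasure] with t ht
      simp only [ht, Pi.zero_apply, map_zero, smul_zero]
    have h2 : ∫ t, φ t • (0 : Lp Y 2 timeMeasure) t ∂timeMeasure = 0 := by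
      rw [integral_congr_ae (g := fun _ => 0), integral_zero]
      filter_upwards [Lp.coeFn_zero Y 2 timeMeasure] with t ht
      simp only [ht, Pi.zero_apply, smul_zero]
    simp only [WithLp.zero_fst, WithLp.zero_snd]
    rw [h1, h2, neg_zero]
  add_mem' := by
    intro p q hp hq φ hφ
    have hd : Continuous (deriv φ) := hφ.contDiff.continuous_deriv le_rfl
    have hi : ∀ f : Lp X 2 timeMeasure,
        Integrable (fun t => deriv φ t • ι (f t)) timeMeasure := fun f => by
      simpa using (ι).integrable_comp
        (integrable_test_smul hd hφ.hasCompactSupport.deriv f)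
    have h1 : ∫ t, deriv φ t • ι ((p.fst + q.fst : Lp X 2 timeMeasure) t) ∂timeMeasure
        = (∫ t, deriv φ t • ι (p.fst t) ∂timeMeasure)
          + ∫ t, deriv φ t • ι (q.fst t) ∂timeMeasure := by
      rw [← integral_add (hi _) (hi _)]
      refine integral_congr_ae ?_
      filter_upwards [Lp.coeFn_add p.fst q.fst] with t ht
      simp only [ht, Pi.add_apply, map_add, smul_add]
    have h2 : ∫ t, φ t • (p.snd + q.snd : Lp Y 2 timeMeasure) t ∂timeMeasure
        = (∫ t, φ t • p.snd t ∂timeMeasure) + ∫ t, φ t • q.snd t ∂timeMeasure := by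
      rw [← integral_add
        (integrable_test_smul hφ.contDiff.continuous hφ.hasCompactSupport _)
        (integrable_test_smul hφ.contDiff.continuous hφ.hasCompactSupport _)]
      refine integral_congr_ae ?_
      filter_upwards [Lp.coeFn_add p.snd q.snd] with t ht
      simp only [ht, Pi.add_apply, smul_add]
    simp only [WithLp.add_fst, WithLp.add_snd]
    rw [h1, h2, hp φ hφ, hq φ hφ, neg_add]
  smul_mem' := by
    intro c p hp φ hφ
    have h1 : ∫ t, deriv φ t • ι ((c • p.fst : Lp X 2 timeMeasure) t) ∂timeMeasure
        = c • ∫ t, deriv φ t • ι (p.fst t) ∂timeMeasure := by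
      rw [← integral_smul]
      refine integral_congr_ae ?_
      filter_upwards [Lp.coeFn_smul c p.fst] with t ht
      simp only [ht, Pi.smul_apply, map_smul, smul_comm c]
    have h2 : ∫ t, φ t • (c • p.snd : Lp Y 2 timeMeasure) t ∂timeMeasure
        = c • ∫ t, φ t • p.snd t ∂timeMeasure := by
      rw [← integral_smul]
      refine integral_congr_ae ?_
      filter_upwards [Lp.coeFn_smul c p.snd] with t ht
      simp only [ht, Pi.smul_apply, smul_comm c]
    simp only [WithLp.smul_fst, WithLp.smul_snd]
    rw [h1, h2, hp φ hφ, smul_neg]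

/-- The evolution space
`W(Q_∞) = L²(0,∞; H¹(Ω) ∩ L²₀(Ω)) ∩ H¹(0,∞; [H¹(Ω) ∩ L²₀(Ω)]')` with the norm
`‖y‖² = ∫₀^∞ ‖y(t)‖²_{H¹} + ‖y'(t)‖²_{[H¹]'} dt`. -/
abbrev EvolutionSpace {d : ℕ} (w : L2 d) : Type := SobolevTime (X := H10 w) (Y := H10Dual w) (pivot w)

/-- The value at (almost every) time `t` of an element of `W(Q_∞)`, as a function on the torus. -/
def EvolutionSpace.value {d : ℕ} {w : L2 d} (y : EvolutionSpace w) (t : ℝ) : Torus d → ℝ :=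
  H10.toL2 w (y.1.fst t)

/-- The divergence `∇ · F` of a vector field, acting on `H¹(Ω)`: `φ ↦ -∫_Ω F · ∇φ`. -/
def divergence {d : ℕ} (F : Fin d → Torus d → ℝ) (φ : H1 d) : ℝ :=
  -∫ x, ∑ i, F i x * H1.partial i φ x

/-- The quadratic nonlocal operator `𝒲(u) = ∇ · (u ∇W * u)`, acting on `H¹(Ω)`; `DW` is the gradient
of `W`. -/
def nonlocalOperator {d : ℕ} (DW : Fin d → Torus d → ℝ) (u : Torus d → ℝ) : H1 d → ℝ :=
  divergence fun i x => u x * conv (DW i) u x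

/-- The functional `F` is `𝒰 G`, where `𝒰` is division by `√μ`: for every `φ ∈ H¹(Ω)` also
`φ / √μ ∈ H¹(Ω)`, and `⟨F, φ⟩ = ⟨G, φ / √μ⟩`. -/
def IsGroundStateTransform {d : ℕ} (μ : Torus d → ℝ) (G F : H1 d → ℝ) : Prop :=
  ∀ φ : H1 d, ∃ χ : H1 d,
    (∀ᵐ x, H1.toL2 d χ x = H1.toL2 d φ x / √(μ x)) ∧ F φ = G χ

/-- `F ∈ L²(0,∞; [H¹(Ω)]')` is `e^{-2δt} 𝒰 𝒲(𝒰⁻¹ y)`, where `𝒰⁻¹ y = √μ y`. -/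
def IsTransformedRemainder {d : ℕ} (δ : ℝ) (DW : Fin d → Torus d → ℝ) (μ : Torus d → ℝ) {w : L2 d}
    (y : EvolutionSpace w) (F : Lp (H1Dual d) 2 timeMeasure) : Prop :=
  ∀ᵐ t ∂timeMeasure, IsGroundStateTransform μ
    (fun φ => Real.exp (-2 * δ * t) * nonlocalOperator DW (fun x => √(μ x) * EvolutionSpace.value y t x) φ)
    (F t)

end McKeanVlasov

end

open MeasureTheory McKeanVlasov

/-! With `s = √μ̄` and `m = 1/√μ̄`, the remainder is `e^{-2δt} B(y(t), y(t))` for the bilinear form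
`B(v,u)φ = -∫ s u (∇W * (s v)) · ∇(mφ)`.

`B` is bounded from `L² × L²` to `[H¹]'` (`exists_bilin`). Convolution with `∇W ∈ L^∞` maps `L²`
into `L^∞`, and `φ ↦ ∂ᵢ(mφ)` maps `H¹` into `L²` because `m` is `C¹`. The latter follows from `μ̄ =
Z⁻¹ exp(-(V + W * μ̄)/σ)`, since `W * μ̄` is `C¹` when `W ∈ W^{1,∞}` and `μ̄ ∈ L¹`
(`HasGradW1Infty.hasC1Grad_conv`, `IsStationaryState.exists_sqrt`).

In `B(y,y) - B(z,z) = B(y-z,y) + B(z,y-z)` one factor is bounded in time with values in `L²`, the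
other is square integrable in time. The bounded factor requires the embedding `W(Q_∞) ⊆ L^∞(0,∞;
L²)` (`SobolevTime.ae_norm_le`), proved for an abstract triple `X → H → X'`, which covers both
choices of `L²₀` at once. The weak derivative gives `y(t+h) - y(t) = ∫ₜ^{t+h} y'` in `X'` for almost
every `t`. Pairing this with `y(t+h) + y(t)` turns the left side into `‖y(t+h)‖²_H - ‖y(t)‖²_H`.
Integration in `t`, division by `h` and `h → 0` give the energy bound, with no continuous
representative and no mollification. -/

noncomputable section

namespace McKeanVlasov

open Filter Topology Function

/-! ### Weak time derivatives and the fundamental theorem of calculus -/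

section TimeIntegrals

open scoped Pointwise

/-- This primitive is the test function that turns the weak derivative into a finite difference: its
derivative, paired with `f`, gives `∫ ψ(t) (f(t+h) - f(t)) dt` after a translation. -/
lemma hasDerivAt_integral_window {ψ : ℝ → ℝ} (hψ : Continuous ψ) (h t : ℝ) :
    HasDerivAt (fun t => -∫ r in (0 : ℝ)..h, ψ (t - r)) (ψ (t - h) - ψ t) t := by
  have hI : ∀ a b : ℝ, IntervalIntegrable ψ volume a b := fun a b => hψ.intervalIntegrable a b
  have e : (fun t : ℝ => -∫ r in (0 : ℝ)..h, ψ (t - r))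
      = fun t => (∫ r in (0 : ℝ)..(t - h), ψ r) - ∫ r in (0 : ℝ)..t, ψ r := by
    funext t
    rw [intervalIntegral.integral_comp_sub_left (fun r => ψ r), sub_zero,
      ← intervalIntegral.integral_interval_sub_left (hI 0 t) (hI 0 (t - h)), neg_sub]
  rw [e]
  have h1 : ∀ t : ℝ, HasDerivAt (fun t => ∫ r in (0 : ℝ)..t, ψ r) (ψ t) t := fun t =>
    intervalIntegral.integral_hasDerivAt_right (hI 0 t)
      hψ.stronglyMeasurable.stronglyMeasurableAtFilter hψ.continuousAt
  exact ((h1 (t - h)).comp_sub_const t h).sub (h1 t)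

/-- The support lies in `tsupport ψ + [0, h]`: averaging moves it only to the right, so it stays
inside `(0, ∞)`. -/
lemma isTimeTest_integral_window {ψ : ℝ → ℝ} (hψ : Continuous ψ) (hc : HasCompactSupport ψ)
    (hs : tsupport ψ ⊆ Ioi 0) {h : ℝ} (hh : 0 < h) :
    IsTimeTest (fun t => -∫ r in (0 : ℝ)..h, ψ (t - r)) := by
  have hd := hasDerivAt_integral_window hψ h
  have hK : IsCompact (tsupport ψ + Icc 0 h) := IsCompact.add hc isCompact_Icc
  have hsupp : support (fun t => -∫ r in (0 : ℝ)..h, ψ (t - r)) ⊆ tsupport ψ + Icc 0 h := by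
    intro t ht
    by_contra hcon
    apply ht
    have : ∫ r in (0 : ℝ)..h, ψ (t - r) = ∫ r in (0 : ℝ)..h, (0 : ℝ) := by
      refine intervalIntegral.integral_congr fun r hr => ?_
      rw [uIcc_of_le hh.le] at hr
      by_contra hne
      exact hcon ⟨t - r, subset_tsupport _ hne, r, hr, by simp⟩
    simp [this]
  refine ⟨?_, HasCompactSupport.of_support_subset_isCompact hK hsupp, ?_⟩
  · rw [contDiff_one_iff_deriv]
    refine ⟨fun t => (hd t).differentiableAt, ?_⟩
    rw [show deriv (fun t => -∫ r in (0 : ℝ)..h, ψ (t - r)) = fun t => ψ (t - h) - ψ t from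
      funext fun t => (hd t).deriv]
    fun_prop
  · refine (closure_minimal hsupp hK.isClosed).trans ?_
    rintro _ ⟨a, ha, b, hb, rfl⟩
    exact add_pos_of_pos_of_nonneg (mem_Ioi.1 (hs ha)) hb.1

variable {E : Type*} [NormedAddCommGroup E]

lemma locallyIntegrable_comp_add_right {f : ℝ → E} (hf : LocallyIntegrable f) (h : ℝ) :
    LocallyIntegrable (fun t => f (t + h)) := by
  intro x
  obtain ⟨s, hs, hfs⟩ := hf (x + h)
  refine ⟨(fun t => t + h) ⁻¹' s, (continuous_add_const h).continuousAt.preimage_mem_nhds hs, ?_⟩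
  exact ((measurePreserving_add_right volume h).integrableOn_comp_preimage
    (measurableEmbedding_addRight h)).2 hfs

variable [NormedSpace ℝ E] [CompleteSpace E]

lemma integral_smul_window {ψ : ℝ → ℝ} (hψ : Continuous ψ) (hc : HasCompactSupport ψ)
    {g : ℝ → E} (hg : LocallyIntegrable g) {h : ℝ} (hh : 0 < h) :
    ∫ t, ψ t • ∫ s in t..t + h, g s = ∫ t, (∫ r in (0 : ℝ)..h, ψ (t - r)) • g t := by
  have hK : IsCompact (tsupport ψ + Icc 0 h) := IsCompact.add hc isCompact_Icc
  obtain ⟨C, hC⟩ := hc.exists_bound_of_continuous hψ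
  have hint : Integrable (uncurry fun r t : ℝ => ψ (t - r) • g t)
      ((volume.restrict (uIoc 0 h)).prod volume) := by
    have h1 : Integrable ((tsupport ψ + Icc 0 h).indicator g) :=
      (hg.integrableOn_isCompact hK).integrable_indicator hK.measurableSet
    have : IsFiniteMeasure (volume.restrict (uIoc 0 h)) :=
      ⟨by rw [uIoc_of_le hh.le]; simp⟩
    -- Cutting `g` off outside the compact set `tsupport ψ + [0, h]` makes it integrable and changes
    -- nothing, as `ψ (t - r)` vanishes there for `0 < r ≤ h`.
    have h2 := (h1.comp_snd (volume.restrict (uIoc 0 h))).bdd_smul (φ := fun p => ψ (p.2 - p.1)) C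
      (by fun_prop) (ae_of_all _ fun p => hC _)
    refine h2.congr ?_
    have h3 : ∀ᵐ p ∂((volume.restrict (uIoc 0 h)).prod (volume : Measure ℝ)), p.1 ∈ uIoc 0 h := by
      have := ae_restrict_mem (μ := (volume : Measure ℝ)) (measurableSet_uIoc (a := (0 : ℝ)) (b := h))
      exact Measure.quasiMeasurePreserving_fst.ae this
    filter_upwards [h3] with p hp
    rw [uIoc_of_le hh.le] at hp
    simp only [Pi.smul_apply', uncurry]
    by_cases hpK : p.2 ∈ tsupport ψ + Icc 0 h
    · rw [indicator_of_mem hpK]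
    · rw [indicator_of_notMem hpK, smul_zero]
      have : ψ (p.2 - p.1) = 0 := by
        by_contra hne
        exact hpK ⟨p.2 - p.1, subset_tsupport _ hne, p.1, ⟨hp.1.le, hp.2⟩, by simp⟩
      rw [this, zero_smul]
  have hint' : Integrable (uncurry fun r t : ℝ => ψ t • g (t + r))
      ((volume.restrict (uIoc 0 h)).prod volume) := by
    -- The shear `(r, t) ↦ (r, t + r)` carries one integrand to the other.
    have hmp : MeasurePreserving (fun p : ℝ × ℝ => (p.1, p.2 + p.1))
        ((volume.restrict (uIoc 0 h)).prod volume) ((volume.restrict (uIoc 0 h)).prod volume) :=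
      (MeasurePreserving.id _).skew_product (g := fun r t : ℝ => t + r) (by fun_prop)
        (ae_of_all _ fun r => (measurePreserving_add_right volume r).map_eq)
    have := hmp.integrable_comp_of_integrable hint
    refine this.congr (ae_of_all _ fun p => ?_)
    simp [uncurry, Function.comp]
  have e1 : ∀ t : ℝ, ψ t • ∫ s in t..t + h, g s = ∫ r in (0 : ℝ)..h, ψ t • g (t + r) := by
    intro t
    rw [intervalIntegral.integral_smul, intervalIntegral.integral_comp_add_left (fun s => g s),
      add_zero]
  have e2 : ∀ t : ℝ, (∫ r in (0 : ℝ)..h, ψ (t - r)) • g t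
      = ∫ r in (0 : ℝ)..h, ψ (t - r) • g t := fun t =>
    (intervalIntegral.integral_smul_const _ _).symm
  simp_rw [e1, e2]
  rw [← intervalIntegral_integral_swap hint, ← intervalIntegral_integral_swap hint']
  refine intervalIntegral.integral_congr fun r _ => ?_
  have := integral_add_right_eq_self (μ := (volume : Measure ℝ)) (fun t => ψ (t - r) • g t) r
  simpa using this

/-- A function on `(0, ∞)` with a locally integrable weak derivative satisfies the fundamental
theorem of calculus on almost every interval of given length. -/
lemma ae_sub_eq_integral_of_weakDeriv {f g : ℝ → E} (hf : LocallyIntegrable f)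
    (hg : LocallyIntegrable g)
    (hw : ∀ φ, IsTimeTest φ → ∫ t, deriv φ t • f t = -∫ t, φ t • g t) {h : ℝ} (hh : 0 < h) :
    ∀ᵐ t : ℝ, t ∈ Ioi (0 : ℝ) → f (t + h) - f t - ∫ s in t..t + h, g s = 0 := by
  have hI : ∀ a b : ℝ, IntervalIntegrable g volume a b := fun a b =>
    (hg.integrableOn_isCompact isCompact_uIcc).intervalIntegrable
  have hfh : LocallyIntegrable (fun t => f (t + h)) :=
    locallyIntegrable_comp_add_right hf h
  have hG : Continuous (fun t => ∫ s in t..t + h, g s) := by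
    have h0 := intervalIntegral.continuous_primitive hI 0
    have : (fun t => ∫ s in t..t + h, g s)
        = fun t => (∫ s in (0 : ℝ)..t + h, g s) - ∫ s in (0 : ℝ)..t, g s := by
      funext t
      rw [intervalIntegral.integral_interval_sub_left (hI _ _) (hI _ _)]
    rw [this]
    exact (h0.comp (continuous_id.add continuous_const)).sub h0
  -- Fundamental lemma of the calculus of variations: it suffices to integrate against each smooth
  -- `ψ` with compact support in `(0, ∞)`.
  refine isOpen_Ioi.ae_eq_zero_of_integral_contDiff_smul_eq_zero
    (((hfh.sub hf).sub hG.locallyIntegrable).locallyIntegrableOn _) fun ψ hψ hc hs => ?_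
  have hψc := hψ.continuous
  have hweak := hw _ (isTimeTest_integral_window hψc hc hs hh)
  have hd : deriv (fun t => -∫ r in (0 : ℝ)..h, ψ (t - r)) = fun t => ψ (t - h) - ψ t :=
    funext fun t => (hasDerivAt_integral_window hψc h t).deriv
  have i1 := hfh.integrable_smul_left_of_hasCompactSupport hψc hc
  have i2 := hf.integrable_smul_left_of_hasCompactSupport hψc hc
  have i3 := (hG.locallyIntegrable (μ := volume)).integrable_smul_left_of_hasCompactSupport hψc hc
  have i4 : Integrable (fun t => ψ (t - h) • f t) := by
    have := i1.comp_sub_right h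
    simpa using this
  have e4 : ∫ t, ψ (t - h) • f t = ∫ t, ψ t • f (t + h) := by
    have := integral_add_right_eq_self (μ := (volume : Measure ℝ)) (fun t => ψ (t - h) • f t) h
    simpa using this.symm
  rw [hd] at hweak
  simp only [sub_smul, neg_smul] at hweak
  rw [integral_sub i4 i2, integral_neg, neg_neg, e4, ← integral_smul_window hψc hc hg hh] at hweak
  simp only [smul_sub]
  rw [integral_sub (f := fun t => ψ t • f (t + h) - ψ t • f t) (i1.sub i2) i3,
    integral_sub i1 i2, hweak, sub_self]

end TimeIntegrals

/-! ### The energy estimate and the embedding into `L^∞(0,∞; H)` -/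

section Energy

variable {X H : Type*} [NormedAddCommGroup X] [NormedSpace ℝ X] [NormedAddCommGroup H]
  [InnerProductSpace ℝ H] {T : X →L[ℝ] H} {ι : X →L[ℝ] StrongDual ℝ X}

lemma abs_integral_apply_le {g : ℝ → StrongDual ℝ X} (hg : MemLp g 2) (t : ℝ) {h : ℝ}
    (hh : 0 < h) (x : X) :
    |(∫ s in t..t + h, g s) x| ≤ ((∫ s in t..t + h, ‖g s‖ ^ 2) + h * ‖x‖ ^ 2) / 2 := by
  have hI : IntervalIntegrable g volume t (t + h) :=
    ((hg.locallyIntegrable (by norm_num)).integrableOn_isCompact isCompact_uIcc).intervalIntegrable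
  have hI2 : IntervalIntegrable (fun s => ‖g s‖ ^ 2) volume t (t + h) :=
    (hg.norm.integrable_sq).intervalIntegrable
  have h1 : |(∫ s in t..t + h, g s) x| ≤ ‖∫ s in t..t + h, g s‖ * ‖x‖ :=
    (∫ s in t..t + h, g s).le_opNorm x
  have h2 : ‖∫ s in t..t + h, g s‖ ≤ ∫ s in t..t + h, ‖g s‖ :=
    intervalIntegral.norm_integral_le_integral_norm (by linarith)
  have h3 : (∫ s in t..t + h, ‖g s‖) * ‖x‖ ≤ ∫ s in t..t + h, (‖g s‖ ^ 2 / 2 + ‖x‖ ^ 2 / 2) := by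
    rw [← intervalIntegral.integral_mul_const]
    refine intervalIntegral.integral_mono_on (by linarith) (hI.norm.mul_const _)
      ((hI2.div_const 2).add intervalIntegrable_const) fun s _ => ?_
    nlinarith [sq_nonneg (‖g s‖ - ‖x‖)]
  rw [intervalIntegral.integral_add (hI2.div_const 2) intervalIntegrable_const,
    intervalIntegral.integral_div, intervalIntegral.integral_const] at h3
  have h4 := mul_le_mul_of_nonneg_right h2 (norm_nonneg x)
  simp only [add_sub_cancel_left, smul_eq_mul] at h3
  linarith

/-- By symmetry of the inner product, `‖T x'‖² - ‖T x‖² = (ι x' - ι x)(x' + x)`; this replaces the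
product rule for `d/dt ‖T y‖²`. -/
lemma abs_sq_sub_sq_le (hι : ∀ x x', ι x x' = ⟪T x, T x'⟫) {g : ℝ → StrongDual ℝ X}
    (hg : MemLp g 2) {t h : ℝ} (hh : 0 < h) {x x' : X}
    (hx : ι x' - ι x - ∫ s in t..t + h, g s = 0) :
    |‖T x'‖ ^ 2 - ‖T x‖ ^ 2|
      ≤ (∫ s in t..t + h, ‖g s‖ ^ 2) + h * (‖x‖ ^ 2 + ‖x'‖ ^ 2) / 2 := by
  have e : ‖T x'‖ ^ 2 - ‖T x‖ ^ 2 = (∫ s in t..t + h, g s) x' + (∫ s in t..t + h, g s) x := by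
    rw [← sub_eq_zero.1 hx]
    simp only [_root_.sub_apply, hι, real_inner_self_eq_norm_sq,
      real_inner_comm (T x) (T x')]
    ring
  rw [e]
  have h1 := abs_integral_apply_le hg t hh x
  have h2 := abs_integral_apply_le hg t hh x'
  have h3 := abs_add_le ((∫ s in t..t + h, g s) x') ((∫ s in t..t + h, g s) x)
  linarith

/-- The bound is linear in `h`, so it survives division by `h` as `h → 0`. Integrating in `t` at
fixed `h` also disposes of the exceptional null set of `hyg`, which depends on `h`. -/
lemma abs_integral_sq_sub_le (hι : ∀ x x', ι x x' = ⟪T x, T x'⟫) {y : ℝ → X}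
    {g : ℝ → StrongDual ℝ X} (hy : MemLp y 2) (hg : MemLp g 2) {h : ℝ} (hh : 0 < h)
    (hyg : ∀ᵐ t : ℝ, t ∈ Ioi (0 : ℝ) → ι (y (t + h)) - ι (y t) - ∫ s in t..t + h, g s = 0)
    {a b : ℝ} (ha : 0 < a) (hab : a ≤ b) :
    |(∫ t in b..b + h, ‖T (y t)‖ ^ 2) - ∫ t in a..a + h, ‖T (y t)‖ ^ 2|
      ≤ h * ((∫ t, ‖y t‖ ^ 2) + ∫ t, ‖g t‖ ^ 2) := by
  have hN : Integrable (fun t => ‖T (y t)‖ ^ 2) := (T.comp_memLp' hy).norm.integrable_sq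
  have hY : Integrable (fun t => ‖y t‖ ^ 2) := hy.norm.integrable_sq
  have hG : Integrable (fun t => ‖g t‖ ^ 2) := hg.norm.integrable_sq
  have hYh := hY.comp_add_right h
  have hNh := hN.comp_add_right h
  -- The integrals over `[a+h, b+h]` and `[a, b]` differ only by the two end windows.
  have e1 : (∫ t in b..b + h, ‖T (y t)‖ ^ 2) - ∫ t in a..a + h, ‖T (y t)‖ ^ 2
      = ∫ t in a..b, (‖T (y (t + h))‖ ^ 2 - ‖T (y t)‖ ^ 2) := by
    rw [intervalIntegral.integral_sub hNh.intervalIntegrable hN.intervalIntegrable,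
      intervalIntegral.integral_comp_add_right (fun t => ‖T (y t)‖ ^ 2),
      intervalIntegral.integral_interval_sub_interval_comm hN.intervalIntegrable
        hN.intervalIntegrable hN.intervalIntegrable,
      intervalIntegral.integral_symm a b,
      intervalIntegral.integral_symm (a + h) (b + h)]
    ring
  have hprod : Integrable (uncurry fun r t : ℝ => ‖g (t + r)‖ ^ 2)
      ((volume.restrict (uIoc 0 h)).prod (volume.restrict (uIoc a b))) := by
    have hmp : MeasurePreserving (fun p : ℝ × ℝ => (p.1, p.2 + p.1))
        ((volume.restrict (uIoc 0 h)).prod volume) ((volume.restrict (uIoc 0 h)).prod volume) :=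
      (MeasurePreserving.id _).skew_product (g := fun r t : ℝ => t + r) (by fun_prop)
        (ae_of_all _ fun r => (measurePreserving_add_right volume r).map_eq)
    have : IsFiniteMeasure (volume.restrict (uIoc 0 h)) :=
      ⟨by rw [uIoc_of_le hh.le]; simp⟩
    have := hmp.integrable_comp_of_integrable (hG.comp_snd (volume.restrict (uIoc 0 h)))
    exact this.mono_measure (Measure.prod_mono le_rfl Measure.restrict_le_self)
  have e2 : ∀ t : ℝ, ∫ s in t..t + h, ‖g s‖ ^ 2 = ∫ r in (0 : ℝ)..h, ‖g (t + r)‖ ^ 2 := by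
    intro t
    rw [intervalIntegral.integral_comp_add_left (fun s => ‖g s‖ ^ 2), add_zero]
  have le_full : ∀ {F : ℝ → ℝ}, Integrable F → (∀ t, 0 ≤ F t) → ∫ t in a..b, F t ≤ ∫ t, F t := by
    intro F hF h0
    rw [intervalIntegral.integral_of_le hab]
    exact setIntegral_le_integral hF (ae_of_all _ h0)
  have hGw : IntervalIntegrable (fun t => ∫ s in t..t + h, ‖g s‖ ^ 2) volume a b := by
    have hI : ∀ a b : ℝ, IntervalIntegrable (fun s => ‖g s‖ ^ 2) volume a b :=
      fun a b => hG.intervalIntegrable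
    have h0 := intervalIntegral.continuous_primitive hI 0
    have : (fun t => ∫ s in t..t + h, ‖g s‖ ^ 2)
        = fun t => (∫ s in (0 : ℝ)..t + h, ‖g s‖ ^ 2) - ∫ s in (0 : ℝ)..t, ‖g s‖ ^ 2 := by
      funext t
      rw [intervalIntegral.integral_interval_sub_left (hI _ _) (hI _ _)]
    rw [this]
    exact ((h0.comp (continuous_add_const h)).sub h0).intervalIntegrable _ _
  have hYw : IntervalIntegrable (fun t => h * (‖y t‖ ^ 2 + ‖y (t + h)‖ ^ 2) / 2) volume a b :=
    (((hY.add hYh).const_mul h).div_const 2).intervalIntegrable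
  -- After Fubini, each shift `r ∈ (0, h]` contributes at most the full integral of `‖g‖²`.
  have h1 : ∫ t in a..b, ∫ s in t..t + h, ‖g s‖ ^ 2 ≤ h * ∫ t, ‖g t‖ ^ 2 := by
    simp_rw [e2]
    rw [intervalIntegral.integral_of_le hab]
    rw [uIoc_of_le hab] at hprod
    rw [← intervalIntegral_integral_swap hprod]
    have : ∀ r ∈ uIoc 0 h, ‖∫ t in Ioc a b, ‖g (t + r)‖ ^ 2‖ ≤ ∫ t, ‖g t‖ ^ 2 := by
      intro r _
      rw [Real.norm_of_nonneg (by positivity),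
        ← integral_add_right_eq_self (μ := volume) (fun t => ‖g t‖ ^ 2) r]
      exact setIntegral_le_integral (hG.comp_add_right r) (ae_of_all _ fun t => by positivity)
    have h5 := intervalIntegral.norm_integral_le_of_norm_le_const this
    rw [sub_zero, abs_of_pos hh, mul_comm] at h5
    exact (le_abs_self _).trans h5
  have h2 : ∫ t in a..b, h * (‖y t‖ ^ 2 + ‖y (t + h)‖ ^ 2) / 2 ≤ h * ∫ t, ‖y t‖ ^ 2 := by
    refine (le_full (((hY.add hYh).const_mul h).div_const 2) fun t => ?_).trans_eq ?_
    · simp only [Pi.add_apply]; positivity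
    · simp only [Pi.add_apply]
      rw [integral_div, integral_const_mul, integral_add hY hYh,
        integral_add_right_eq_self (fun t => ‖y t‖ ^ 2) h]
      ring
  rw [e1]
  calc |∫ t in a..b, (‖T (y (t + h))‖ ^ 2 - ‖T (y t)‖ ^ 2)|
      ≤ ∫ t in a..b, |‖T (y (t + h))‖ ^ 2 - ‖T (y t)‖ ^ 2| :=
        intervalIntegral.abs_integral_le_integral_abs hab
    _ ≤ ∫ t in a..b, ((∫ s in t..t + h, ‖g s‖ ^ 2) + h * (‖y t‖ ^ 2 + ‖y (t + h)‖ ^ 2) / 2) := by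
        refine intervalIntegral.integral_mono_ae_restrict hab
          (hNh.sub hN).abs.intervalIntegrable (hGw.add hYw) ?_
        filter_upwards [ae_restrict_of_ae hyg, ae_restrict_mem measurableSet_Icc] with t ht hmem
        exact abs_sq_sub_sq_le hι hg hh (ht (ha.trans_le hmem.1))
    _ ≤ h * ((∫ t, ‖y t‖ ^ 2) + ∫ t, ‖g t‖ ^ 2) := by
        rw [intervalIntegral.integral_add hGw hYw]
        linarith

/-- Lebesgue differentiation recovers the pointwise values from window averages as `h → 0⁺`, at
almost every `a` and `b`. -/
lemma ae_ae_abs_sq_sub_sq_le (hι : ∀ x x', ι x x' = ⟪T x, T x'⟫) {y : ℝ → X}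
    {g : ℝ → StrongDual ℝ X} (hy : MemLp y 2) (hg : MemLp g 2)
    (hyg : ∀ h : ℝ, 0 < h →
      ∀ᵐ t : ℝ, t ∈ Ioi (0 : ℝ) → ι (y (t + h)) - ι (y t) - ∫ s in t..t + h, g s = 0) :
    ∀ᵐ b : ℝ, ∀ᵐ a : ℝ, 0 < a → 0 < b →
      ‖T (y b)‖ ^ 2 ≤ ‖T (y a)‖ ^ 2 + ((∫ t, ‖y t‖ ^ 2) + ∫ t, ‖g t‖ ^ 2) := by
  have hN : Integrable (fun t => ‖T (y t)‖ ^ 2) := (T.comp_memLp' hy).norm.integrable_sq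
  set M := (∫ t, ‖y t‖ ^ 2) + ∫ t, ‖g t‖ ^ 2
  have hL : ∀ᵐ x : ℝ, Tendsto (fun h => h⁻¹ * ∫ t in x..x + h, ‖T (y t)‖ ^ 2) (𝓝[>] 0)
      (𝓝 (‖T (y x)‖ ^ 2)) := by
    filter_upwards [LocallyIntegrable.ae_hasDerivAt_integral hN.locallyIntegrable] with x hx
    have := (hx x).tendsto_slope_zero_right
    simpa using this
  have key : ∀ {a b : ℝ}, 0 < a → a ≤ b →
      Tendsto (fun h => h⁻¹ * ∫ t in a..a + h, ‖T (y t)‖ ^ 2) (𝓝[>] 0) (𝓝 (‖T (y a)‖ ^ 2)) →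
      Tendsto (fun h => h⁻¹ * ∫ t in b..b + h, ‖T (y t)‖ ^ 2) (𝓝[>] 0) (𝓝 (‖T (y b)‖ ^ 2)) →
      |‖T (y b)‖ ^ 2 - ‖T (y a)‖ ^ 2| ≤ M := by
    intro a b ha hab hla hlb
    refine le_of_tendsto (hlb.sub hla).abs ?_
    filter_upwards [self_mem_nhdsWithin] with h hh
    have hh : 0 < h := hh
    rw [← mul_sub, abs_mul, abs_of_pos (inv_pos.2 hh), inv_mul_le_iff₀ hh]
    exact abs_integral_sq_sub_le hι hy hg hh (hyg h hh) ha hab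
  filter_upwards [hL] with b hb
  filter_upwards [hL] with a ha
  intro ha0 hb0
  rcases le_total a b with hab | hab
  · linarith [(abs_le.1 (key ha0 hab ha hb)).2]
  · linarith [(abs_le.1 (key hb0 hab hb ha)).1]

lemma ae_sq_le (hι : ∀ x x', ι x x' = ⟪T x, T x'⟫) {y : ℝ → X}
    {g : ℝ → StrongDual ℝ X} (hy : MemLp y 2) (hg : MemLp g 2)
    (hyg : ∀ h : ℝ, 0 < h →
      ∀ᵐ t : ℝ, t ∈ Ioi (0 : ℝ) → ι (y (t + h)) - ι (y t) - ∫ s in t..t + h, g s = 0) :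
    ∀ᵐ b : ℝ, 0 < b →
      ‖T (y b)‖ ^ 2 ≤ (‖T‖ ^ 2 + 1) * ((∫ t, ‖y t‖ ^ 2) + ∫ t, ‖g t‖ ^ 2) := by
  have hN : Integrable (fun t => ‖T (y t)‖ ^ 2) := (T.comp_memLp' hy).norm.integrable_sq
  have hY : Integrable (fun t => ‖y t‖ ^ 2) := hy.norm.integrable_sq
  filter_upwards [ae_ae_abs_sq_sub_sq_le hι hy hg hyg] with b hb hb0
  set M := (∫ t, ‖y t‖ ^ 2) + ∫ t, ‖g t‖ ^ 2
  -- Averaging over the starting time `a ∈ (0, 1)` removes the unknown initial value: its mean is at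
  -- most `‖T‖² ∫ ‖y‖²`.
  have h1 : ∫ a in (0 : ℝ)..1, ‖T (y b)‖ ^ 2 ≤ ∫ a in (0 : ℝ)..1, (‖T (y a)‖ ^ 2 + M) := by
    rw [intervalIntegral.integral_of_le zero_le_one, intervalIntegral.integral_of_le zero_le_one]
    refine setIntegral_mono_on_ae (by simp) ?_ measurableSet_Ioc ?_
    · exact hN.integrableOn.add (by simp)
    · filter_upwards [hb] with a ha hmem using ha hmem.1 hb0
  rw [intervalIntegral.integral_add hN.intervalIntegrable intervalIntegrable_const] at h1
  simp only [intervalIntegral.integral_const, sub_zero, one_smul] at h1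
  have h2 : ∫ a in (0 : ℝ)..1, ‖T (y a)‖ ^ 2 ≤ ‖T‖ ^ 2 * ∫ t, ‖y t‖ ^ 2 := by
    rw [intervalIntegral.integral_of_le zero_le_one, ← integral_const_mul]
    refine (setIntegral_le_integral hN (ae_of_all _ fun t => by positivity)).trans
      (integral_mono hN (hY.const_mul _) fun t => ?_)
    simp only
    rw [← mul_pow]
    exact pow_le_pow_left₀ (norm_nonneg _) (T.le_opNorm _) 2
  have h3 : 0 ≤ ∫ t, ‖g t‖ ^ 2 := by positivity
  have h4 := mul_nonneg (sq_nonneg ‖T‖) h3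
  linarith

lemma norm_sq_eq_integral {α G : Type*} [MeasurableSpace α] {μ : Measure α} [NormedAddCommGroup G]
    (f : Lp G 2 μ) : ‖f‖ ^ 2 = ∫ x, ‖f x‖ ^ 2 ∂μ := by
  have h0 : 0 ≤ ∫ x, ‖f x‖ ^ 2 ∂μ := by positivity
  rw [Lp.norm_def, (Lp.memLp f).eLpNorm_eq_integral_rpow_norm (by norm_num) (by norm_num),
    ENNReal.toReal_ofReal (by positivity)]
  simp only [ENNReal.toReal_ofNat, Real.rpow_two]
  rw [← Real.rpow_natCast, ← Real.rpow_mul h0]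
  norm_num

/-- The embedding `L²(0,∞; X) ∩ H¹(0,∞; X') ⊆ L^∞(0,∞; H)` for a triple `X → H → X'`. -/
theorem SobolevTime.ae_norm_le (hι : ∀ x x', ι x x' = ⟪T x, T x'⟫) (p : SobolevTime ι) :
    ∀ᵐ t ∂timeMeasure, ‖T (p.1.fst t)‖ ≤ √(‖T‖ ^ 2 + 1) * ‖p‖ := by
  -- Extension by zero to `ℝ`. A jump at `0` is harmless, as test functions are supported in `(0,
  -- ∞)`.
  set y := (Ioi (0 : ℝ)).indicator (p.1.fst)
  set g := (Ioi (0 : ℝ)).indicator (p.1.snd)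
  have hy : MemLp y 2 := (memLp_indicator_iff_restrict measurableSet_Ioi).2 (Lp.memLp p.1.fst)
  have hg : MemLp g 2 := (memLp_indicator_iff_restrict measurableSet_Ioi).2 (Lp.memLp p.1.snd)
  have hιy : LocallyIntegrable (fun t => ι (y t)) :=
    (ι.comp_memLp' hy).locallyIntegrable (by norm_num)
  have hw : ∀ φ, IsTimeTest φ → ∫ t, deriv φ t • ι (y t) = -∫ t, φ t • g t := by
    intro φ hφ
    have := p.2 φ hφ
    rw [← integral_indicator measurableSet_Ioi, ← integral_indicator measurableSet_Ioi] at this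
    have e1 : ∀ t, deriv φ t • ι (y t)
        = (Ioi (0 : ℝ)).indicator (fun t => deriv φ t • ι (p.1.fst t)) t := fun t => by
      by_cases ht : t ∈ Ioi (0 : ℝ)
      · simp only [y, indicator_of_mem ht]
      · simp only [y, indicator_of_notMem ht, map_zero, smul_zero]
    have e2 : ∀ t, φ t • g t = (Ioi (0 : ℝ)).indicator (fun t => φ t • p.1.snd t) t := fun t => by
      by_cases ht : t ∈ Ioi (0 : ℝ)
      · simp only [g, indicator_of_mem ht]
      · simp only [g, indicator_of_notMem ht, smul_zero]
    simp_rw [e1, e2]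
    exact this
  have hFTC := fun (h : ℝ) (hh : 0 < h) =>
    ae_sub_eq_integral_of_weakDeriv hιy (hg.locallyIntegrable (by norm_num)) hw hh
  have hsq : (∫ t, ‖y t‖ ^ 2) + ∫ t, ‖g t‖ ^ 2 = ‖p‖ ^ 2 := by
    have e : ‖p‖ ^ 2 = ‖p.1.fst‖ ^ 2 + ‖p.1.snd‖ ^ 2 := WithLp.prod_norm_sq_eq_of_L2 p.1
    rw [e, norm_sq_eq_integral, norm_sq_eq_integral, ← integral_indicator measurableSet_Ioi,
      ← integral_indicator measurableSet_Ioi]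
    congr 1
    · refine integral_congr_ae (ae_of_all _ fun t => ?_)
      by_cases ht : t ∈ Ioi (0 : ℝ) <;> simp [y, ht]
    · refine integral_congr_ae (ae_of_all _ fun t => ?_)
      by_cases ht : t ∈ Ioi (0 : ℝ) <;> simp [g, ht]
  have := ae_sq_le hι hy hg hFTC
  filter_upwards [ae_restrict_of_ae this, ae_restrict_mem measurableSet_Ioi] with t ht hmem
  have h1 := ht hmem
  rw [hsq] at h1
  have h2 : y t = p.1.fst t := indicator_of_mem hmem _
  rw [h2] at h1
  refine abs_le_of_sq_le_sq' (a := ‖T (p.1.fst t)‖) ?_ (by positivity) |>.2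
  rw [mul_pow, Real.sq_sqrt (by positivity)]
  exact h1

end Energy

/-! ### Density of `C¹` functions and regularity of convolutions on the torus -/

section Torus

variable {d : ℕ}

instance Torus.instIsNegInvariant (d : ℕ) :
    Measure.IsNegInvariant (volume : Measure (Torus d)) :=
  Measure.IsAddHaarMeasure.isNegInvariant_of_regular _

/-! ### Functions of class `C¹` on the torus -/

lemma HasC1Grad.hasDerivAt_shift {f : Torus d → ℝ} {Df : Fin d → Torus d → ℝ}
    (hf : HasC1Grad f Df) (i : Fin d) (x : Torus d) (s : ℝ) :
    HasDerivAt (fun s : ℝ => f (x + Pi.single i (s : AddCircle (2 * Real.pi))))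
      (Df i (x + Pi.single i (s : AddCircle (2 * Real.pi)))) s := by
  have h := hf.hasDerivAt i (x + Pi.single i (s : AddCircle (2 * Real.pi)))
  rw [← sub_self s] at h
  refine (h.comp_sub_const s s).congr_of_eventuallyEq (Eventually.of_forall fun r => ?_)
  simp only [add_assoc, ← Pi.single_add, ← AddCircle.coe_add, add_sub_cancel]

lemma HasC1Grad.of_comp {f : Torus d → ℝ} {Df : Fin d → Torus d → ℝ} (hf : HasC1Grad f Df)
    {g g' : ℝ → ℝ} (hg : ∀ r, HasDerivAt g (g' r) r) (hg' : Continuous g') :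
    HasC1Grad (fun x => g (f x)) (fun i x => g' (f x) * Df i x) where
  continuous := (continuous_iff_continuousAt.2 fun r => (hg r).continuousAt).comp hf.continuous
  continuous_grad i := (hg'.comp hf.continuous).mul (hf.continuous_grad i)
  hasDerivAt i x := by
    have h := hf.hasDerivAt i x
    have h0 : f x = f (x + Pi.single i ((0 : ℝ) : AddCircle (2 * Real.pi))) := by simp
    have hg0 := hg (f x)
    rw [h0] at hg0
    have := hg0.comp (0 : ℝ) h
    rwa [← h0] at this

lemma HasC1Grad.add {f g : Torus d → ℝ} {Df Dg : Fin d → Torus d → ℝ} (hf : HasC1Grad f Df)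
    (hg : HasC1Grad g Dg) : HasC1Grad (fun x => f x + g x) (fun i x => Df i x + Dg i x) where
  continuous := hf.continuous.add hg.continuous
  continuous_grad i := (hf.continuous_grad i).add (hg.continuous_grad i)
  hasDerivAt i x := (hf.hasDerivAt i x).add (hg.hasDerivAt i x)

lemma HasC1Grad.mul {f g : Torus d → ℝ} {Df Dg : Fin d → Torus d → ℝ} (hf : HasC1Grad f Df)
    (hg : HasC1Grad g Dg) :
    HasC1Grad (fun x => f x * g x) (fun i x => Df i x * g x + f x * Dg i x) where
  continuous := hf.continuous.mul hg.continuous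
  continuous_grad i := ((hf.continuous_grad i).mul hg.continuous).add
    (hf.continuous.mul (hg.continuous_grad i))
  hasDerivAt i x := by
    have h := (hf.hasDerivAt i x).mul (hg.hasDerivAt i x)
    simp only [AddCircle.coe_zero, Pi.single_zero, add_zero] at h
    exact h

lemma hasC1Grad_const (c : ℝ) : HasC1Grad (fun _ : Torus d => c) (fun _ _ => 0) where
  continuous := continuous_const
  continuous_grad _ := continuous_const
  hasDerivAt _ _ := hasDerivAt_const _ _

lemma HasC1Grad.comp_sub_left {f : Torus d → ℝ} {Df : Fin d → Torus d → ℝ} (hf : HasC1Grad f Df)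
    (x : Torus d) : HasC1Grad (fun z => f (x - z)) (fun i z => -Df i (x - z)) where
  continuous := hf.continuous.comp (continuous_const.sub continuous_id)
  continuous_grad i := ((hf.continuous_grad i).comp (continuous_const.sub continuous_id)).neg
  hasDerivAt i z := by
    have h := hf.hasDerivAt i (x - z)
    rw [← neg_zero] at h
    have h2 := h.comp (0 : ℝ) (hasDerivAt_neg (0 : ℝ))
    rw [mul_neg_one] at h2
    refine h2.congr_of_eventuallyEq (Eventually.of_forall fun r => ?_)
    simp only [comp, AddCircle.coe_neg, Pi.single_neg]
    congr 1
    abel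

lemma hasC1Grad_coord {g g' : AddCircle (2 * Real.pi) → ℝ} (hg : Continuous g)
    (hg' : Continuous g')
    (h : ∀ θ, HasDerivAt (fun s : ℝ => g (θ + (s : AddCircle (2 * Real.pi)))) (g' θ) 0)
    (j : Fin d) :
    HasC1Grad (fun x : Torus d => g (x j)) (fun i x => if i = j then g' (x j) else 0) where
  continuous := hg.comp (continuous_apply j)
  continuous_grad i := by
    by_cases hij : i = j
    · simp only [hij, if_true]
      exact hg'.comp (continuous_apply j)
    · simp only [hij, if_false]
      exact continuous_const
  hasDerivAt i x := by
    by_cases hij : i = j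
    · subst hij
      simpa using h (x i)
    · have hji : j ≠ i := fun h => hij h.symm
      simpa [hij, Pi.single_eq_of_ne hji] using hasDerivAt_const (0 : ℝ) (g (x j))

lemma hasDerivAt_angle_sin (θ : AddCircle (2 * Real.pi)) :
    HasDerivAt (fun s : ℝ => Real.Angle.sin (θ + (s : AddCircle (2 * Real.pi)) : AddCircle _))
      (Real.Angle.cos θ) 0 := by
  induction θ using QuotientAddGroup.induction_on with
  | H r =>
    have h := (Real.hasDerivAt_sin (r + 0)).comp_const_add r 0
    rw [add_zero] at h
    exact h

lemma hasDerivAt_angle_cos (θ : AddCircle (2 * Real.pi)) :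
    HasDerivAt (fun s : ℝ => Real.Angle.cos (θ + (s : AddCircle (2 * Real.pi)) : AddCircle _))
      (-Real.Angle.sin θ) 0 := by
  induction θ using QuotientAddGroup.induction_on with
  | H r =>
    have h := (Real.hasDerivAt_cos (r + 0)).comp_const_add r 0
    rw [add_zero] at h
    exact h

/-- The algebra of `C¹` functions on the torus. -/
def c1Subalgebra (d : ℕ) : Subalgebra ℝ C(Torus d, ℝ) where
  carrier := {f | ∃ Df, HasC1Grad f Df}
  mul_mem' := by
    rintro f g ⟨Df, hf⟩ ⟨Dg, hg⟩
    exact ⟨_, hf.mul hg⟩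
  add_mem' := by
    rintro f g ⟨Df, hf⟩ ⟨Dg, hg⟩
    exact ⟨_, hf.add hg⟩
  algebraMap_mem' c := ⟨_, hasC1Grad_const c⟩

/-- The sine and cosine of each coordinate are `C¹` and together determine that coordinate modulo
`2π`. -/
lemma c1Subalgebra_separatesPoints (d : ℕ) : (c1Subalgebra d).SeparatesPoints := by
  intro x y hxy
  by_contra hcon
  have key : ∀ (f : Torus d → ℝ) (Df : Fin d → Torus d → ℝ), HasC1Grad f Df → f x = f y := by
    intro f Df hf
    by_contra hne
    exact hcon ⟨f, ⟨⟨f, hf.continuous⟩, ⟨Df, hf⟩, rfl⟩, hne⟩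
  refine hxy (funext fun j => ?_)
  have hs := key _ _ (hasC1Grad_coord (d := d) Real.Angle.continuous_sin Real.Angle.continuous_cos
    hasDerivAt_angle_sin j)
  have hc := key _ _ (hasC1Grad_coord (d := d) Real.Angle.continuous_cos
    Real.Angle.continuous_sin.neg hasDerivAt_angle_cos j)
  generalize x j = a at hs hc
  generalize y j = b at hs hc
  induction a using QuotientAddGroup.induction_on with
  | H a =>
    induction b using QuotientAddGroup.induction_on with
    | H b => exact Real.Angle.cos_sin_inj hc hs

/-- Continuous functions are dense in `L¹`, and Stone–Weierstrass approximates them uniformly by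
`C¹` functions; the torus has finite measure. -/
lemma exists_hasC1Grad_integral_sub_le {u : Torus d → ℝ} (hu : Integrable u) {ε : ℝ} (hε : 0 < ε) :
    ∃ (φ : Torus d → ℝ) (Dφ : Fin d → Torus d → ℝ), HasC1Grad φ Dφ ∧ ∫ x, |u x - φ x| ≤ ε := by
  obtain ⟨g, hg, hgi⟩ := hu.exists_boundedContinuous_integral_sub_le (half_pos hε)
  set m := (volume : Measure (Torus d)).real univ
  have hm : 0 ≤ m := measureReal_nonneg
  have hη : 0 < ε / (2 * (m + 1)) := by positivity
  obtain ⟨⟨φ, Dφ, hφ⟩, hφg⟩ :=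
    ContinuousMap.exists_mem_subalgebra_near_continuous_of_separatesPoints _
      (c1Subalgebra_separatesPoints d) g g.continuous _ hη
  refine ⟨φ, Dφ, hφ, ?_⟩
  have hφi : Integrable φ := φ.continuous.integrable_of_hasCompactSupport
    (HasCompactSupport.of_compactSpace _)
  calc ∫ x, |u x - φ x| ≤ ∫ x, (|u x - g x| + ε / (2 * (m + 1))) := by
        refine integral_mono (hu.sub hφi).abs ((hu.sub hgi).abs.add (integrable_const _))
          fun x => ?_
        have h1 := hφg x
        rw [Real.norm_eq_abs, abs_sub_comm] at h1
        exact (abs_sub_le _ (g x) _).trans (add_le_add le_rfl h1.le)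
    _ = (∫ x, |u x - g x|) + m * (ε / (2 * (m + 1))) := by
        rw [integral_add (f := fun x => |u x - g x|) (hu.sub hgi).abs (integrable_const _), integral_const, smul_eq_mul]
    _ ≤ ε / 2 + ε / 2 := by
        refine add_le_add hg ?_
        rw [← mul_div_assoc, div_le_div_iff₀ (by positivity) (by positivity)]
        nlinarith
    _ = ε := add_halves ε

/-! ### Convolution -/

lemma integrable_of_memLp_top {k : Torus d → ℝ} (hk : MemLp k ∞) : Integrable k :=
  hk.integrable le_top

lemma ae_norm_le_of_memLp_top {k : Torus d → ℝ} (hk : MemLp k ∞) :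
    ∃ K : ℝ, 0 ≤ K ∧ ∀ᵐ x, |k x| ≤ K :=
  ⟨(eLpNormEssSup k volume).toReal, ENNReal.toReal_nonneg, by
    have hfin : eLpNormEssSup k volume ≠ ∞ := by simpa using hk.2.ne
    filter_upwards [enorm_ae_le_eLpNormEssSup k volume] with x hx
    have := ENNReal.toReal_mono hfin hx
    simpa using this⟩

lemma conv_eq_integral_sub (k u : Torus d → ℝ) (x : Torus d) :
    conv k u x = ∫ z, k z * u (x - z) := by
  rw [conv, ← integral_sub_left_eq_self (fun z => k z * u (x - z)) volume x]
  simp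

lemma integrable_conv {k u : Torus d → ℝ} (hk : MemLp k ∞) (hu : Integrable u) (x : Torus d) :
    Integrable (fun x' => k (x - x') * u x') := by
  obtain ⟨K, -, hK⟩ := ae_norm_le_of_memLp_top hk
  have hmp := Measure.measurePreserving_sub_left (volume : Measure (Torus d)) x
  exact hu.bdd_mul (hk.1.comp_measurePreserving hmp) (hmp.quasiMeasurePreserving.ae hK)

lemma conv_sub {k u v : Torus d → ℝ} (hk : MemLp k ∞) (hu : Integrable u) (hv : Integrable v)
    (x : Torus d) : conv k (fun x => u x - v x) x = conv k u x - conv k v x := by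
  simp only [conv, mul_sub]
  exact integral_sub (integrable_conv hk hu x) (integrable_conv hk hv x)

lemma abs_conv_le {k u : Torus d → ℝ} {K : ℝ} (hK : ∀ᵐ x, |k x| ≤ K)
    (hu : Integrable u) (x : Torus d) : |conv k u x| ≤ K * ∫ x, |u x| := by
  have hmp := Measure.measurePreserving_sub_left (volume : Measure (Torus d)) x
  rw [conv, ← integral_const_mul]
  rw [← Real.norm_eq_abs]
  refine norm_integral_le_of_norm_le (hu.abs.const_mul K) ?_
  filter_upwards [hmp.quasiMeasurePreserving.ae hK] with z hz
  rw [Real.norm_eq_abs, abs_mul]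
  exact mul_le_mul_of_nonneg_right hz (abs_nonneg _)

lemma exists_abs_le_of_continuous {φ : Torus d → ℝ} (hφ : Continuous φ) : ∃ C, ∀ x, |φ x| ≤ C := by
  obtain ⟨C, hC⟩ := isCompact_univ.exists_bound_of_continuousOn hφ.continuousOn
  exact ⟨C, fun x => hC x (mem_univ x)⟩

lemma continuous_conv_of_continuous {k φ : Torus d → ℝ} (hk : Integrable k) (hφ : Continuous φ) :
    Continuous (conv k φ) := by
  obtain ⟨C, hC⟩ := exists_abs_le_of_continuous hφ
  have : conv k φ = fun x => ∫ z, k z * φ (x - z) := funext (conv_eq_integral_sub k φ)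
  rw [this]
  refine continuous_of_dominated (bound := fun z => |k z| * C) (fun x => ?_) (fun x => ?_)
    (hk.abs.mul_const C) (ae_of_all _ fun z => ?_)
  · exact hk.1.mul (hφ.comp (continuous_const.sub continuous_id)).aestronglyMeasurable
  · refine ae_of_all _ fun z => ?_
    rw [Real.norm_eq_abs, abs_mul]
    exact mul_le_mul_of_nonneg_left (hC _) (abs_nonneg _)
  · exact continuous_const.mul (hφ.comp (continuous_id.sub continuous_const))

lemma HasC1Grad.conv_right {k φ : Torus d → ℝ} {Dφ : Fin d → Torus d → ℝ} (hk : Integrable k)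
    (hφ : HasC1Grad φ Dφ) : HasC1Grad (conv k φ) (fun i => conv k (Dφ i)) where
  continuous := continuous_conv_of_continuous hk hφ.continuous
  continuous_grad i := continuous_conv_of_continuous hk (hφ.continuous_grad i)
  hasDerivAt i x := by
    obtain ⟨C, hC⟩ := exists_abs_le_of_continuous (hφ.continuous_grad i)
    have hmeas : ∀ (ψ : Torus d → ℝ), Continuous ψ → ∀ y : Torus d,
        AEStronglyMeasurable (fun z => k z * ψ (y - z)) := fun ψ hψ y =>
      hk.1.mul (hψ.comp (continuous_const.sub continuous_id)).aestronglyMeasurable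
    obtain ⟨B, hB⟩ := exists_abs_le_of_continuous hφ.continuous
    have h := (hasDerivAt_integral_of_dominated_loc_of_deriv_le (μ := (volume : Measure (Torus d)))
      (F := fun (s : ℝ) z => k z * φ (x + Pi.single i (s : AddCircle (2 * Real.pi)) - z))
      (F' := fun (s : ℝ) z => k z * Dφ i (x + Pi.single i (s : AddCircle (2 * Real.pi)) - z))
      (bound := fun z => |k z| * C) (x₀ := (0 : ℝ)) (s := univ) univ_mem
      (Eventually.of_forall fun s => hmeas φ hφ.continuous _)
      ((hk.abs.mul_const B).mono' (hmeas φ hφ.continuous _) (ae_of_all _ fun z => ?_))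
      (hmeas _ (hφ.continuous_grad i) _) (ae_of_all _ fun z s _ => ?_) (hk.abs.mul_const C)
      (ae_of_all _ fun z s _ => ?_)).2
    · simp only [conv_eq_integral_sub]
      simpa using h
    · rw [Real.norm_eq_abs, abs_mul]
      exact mul_le_mul_of_nonneg_left (hB _) (abs_nonneg _)
    · rw [Real.norm_eq_abs, abs_mul]
      exact mul_le_mul_of_nonneg_left (hC _) (abs_nonneg _)
    · have := (hφ.hasDerivAt_shift i (x - z) s).const_mul (k z)
      simpa only [add_sub_right_comm] using this

/-- The weak gradient of `W` is tested against `z ↦ φ (x - z)`; the sign from the reflection cancels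
the one from integration by parts. -/
lemma conv_grad_eq {W : Torus d → ℝ} {DW : Fin d → Torus d → ℝ} (hW : HasGradW1Infty W DW)
    {φ : Torus d → ℝ} {Dφ : Fin d → Torus d → ℝ} (hφ : HasC1Grad φ Dφ) (i : Fin d) :
    conv W (Dφ i) = conv (DW i) φ := by
  funext x
  have := hW.weak i _ _ (hφ.comp_sub_left x)
  rw [conv_eq_integral_sub, conv_eq_integral_sub]
  simp only [mul_neg, integral_neg, neg_inj] at this
  exact this

/-- Every integrable function is an `L¹` limit of `C¹` functions. -/
lemma exists_seq_hasC1Grad {u : Torus d → ℝ} (hu : Integrable u) :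
    ∃ (φ : ℕ → Torus d → ℝ) (Dφ : ℕ → Fin d → Torus d → ℝ), (∀ n, HasC1Grad (φ n) (Dφ n)) ∧
      Tendsto (fun n => ∫ x, |u x - φ n x|) atTop (𝓝 0) := by
  choose φ Dφ hφ hle using fun n : ℕ =>
    exists_hasC1Grad_integral_sub_le hu (ε := 1 / ((n : ℝ) + 1)) (by positivity)
  exact ⟨φ, Dφ, hφ, squeeze_zero (fun n => by positivity) hle tendsto_one_div_add_atTop_nhds_zero_nat⟩

lemma tendstoUniformly_conv {k u : Torus d → ℝ} (hk : MemLp k ∞) (hu : Integrable u)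
    {φ : ℕ → Torus d → ℝ} (hφ : ∀ n, Continuous (φ n))
    (hlim : Tendsto (fun n => ∫ x, |u x - φ n x|) atTop (𝓝 0)) :
    TendstoUniformly (fun n => conv k (φ n)) (conv k u) atTop := by
  obtain ⟨K, hK0, hK⟩ := ae_norm_le_of_memLp_top hk
  rw [Metric.tendstoUniformly_iff]
  intro ε hε
  have h := hlim.const_mul K
  rw [mul_zero] at h
  filter_upwards [h.eventually_lt_const hε] with n hn x
  have hφi : Integrable (φ n) := (hφ n).integrable_of_hasCompactSupport
    (HasCompactSupport.of_compactSpace _)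
  rw [Real.dist_eq, ← conv_sub hk hu hφi]
  exact (abs_conv_le hK (hu.sub hφi) x).trans_lt hn

lemma continuous_conv {k u : Torus d → ℝ} (hk : MemLp k ∞) (hu : Integrable u) :
    Continuous (conv k u) := by
  obtain ⟨φ, Dφ, hφ, hlim⟩ := exists_seq_hasC1Grad hu
  exact (tendstoUniformly_conv hk hu (fun n => (hφ n).continuous) hlim).continuous
    (Eventually.of_forall fun n =>
      continuous_conv_of_continuous (integrable_of_memLp_top hk) (hφ n).continuous).frequently

/-- The convolution of a `W^{1,∞}` function with an integrable function is of class `C¹`. -/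
lemma HasGradW1Infty.hasC1Grad_conv {W : Torus d → ℝ} {DW : Fin d → Torus d → ℝ}
    (hW : HasGradW1Infty W DW) {u : Torus d → ℝ} (hu : Integrable u) :
    HasC1Grad (conv W u) (fun i => conv (DW i) u) where
  continuous := continuous_conv hW.memLp hu
  continuous_grad i := continuous_conv (hW.memLp_grad i) hu
  hasDerivAt i x := by
    obtain ⟨φ, Dφ, hφ, hlim⟩ := exists_seq_hasC1Grad hu
    have h1 := tendstoUniformly_conv hW.memLp hu (fun n => (hφ n).continuous) hlim
    have h2 := tendstoUniformly_conv (hW.memLp_grad i) hu (fun n => (hφ n).continuous) hlim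
    have hder : ∀ n (s : ℝ),
        HasDerivAt (fun s : ℝ => conv W (φ n) (x + Pi.single i (s : AddCircle (2 * Real.pi))))
          (conv (DW i) (φ n) (x + Pi.single i (s : AddCircle (2 * Real.pi)))) s := by
      intro n s
      rw [← conv_grad_eq hW (hφ n)]
      exact ((hφ n).conv_right (integrable_of_memLp_top hW.memLp)).hasDerivAt_shift i x s
    have h2' := h2.comp fun s : ℝ => x + Pi.single i (s : AddCircle (2 * Real.pi))
    have hpt : ∀ s : ℝ, Tendsto
        (fun n => conv W (φ n) (x + Pi.single i (s : AddCircle (2 * Real.pi)))) atTop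
        (𝓝 (conv W u (x + Pi.single i (s : AddCircle (2 * Real.pi))))) := fun s =>
      h1.tendsto_at _
    -- The `L^∞`–`L¹` bound makes the convolutions and their derivatives converge uniformly, so the
    -- limit may be differentiated.
    have h := hasDerivAt_of_tendstoUniformly h2' (Eventually.of_forall hder) hpt 0
    simp only [comp, AddCircle.coe_zero, Pi.single_zero, add_zero] at h
    exact h

end Torus

/-! ### Quadratic maps on the evolution space -/

section Quadratic

variable {X H Z : Type*} [NormedAddCommGroup X] [NormedSpace ℝ X] [NormedAddCommGroup H]
  [InnerProductSpace ℝ H] [NormedAddCommGroup Z] [NormedSpace ℝ Z]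
  {T : X →L[ℝ] H} {ι : X →L[ℝ] StrongDual ℝ X}

lemma norm_bilin_self_sub_le (B : H →L[ℝ] H →L[ℝ] Z) (a b : H) :
    ‖B a a - B b b‖ ≤ ‖B‖ * (‖a‖ + ‖b‖) * ‖a - b‖ := by
  have e : B a a - B b b = B (a - b) a + B b (a - b) := by simp
  rw [e]
  calc ‖B (a - b) a + B b (a - b)‖ ≤ ‖B‖ * ‖a - b‖ * ‖a‖ + ‖B‖ * ‖b‖ * ‖a - b‖ :=
        (norm_add_le _ _).trans (add_le_add (B.le_opNorm₂ _ _) (B.le_opNorm₂ _ _))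
    _ = _ := by ring

/-- A quadratic map on `H`, damped by a weight `0 ≤ c ≤ 1`, induces a locally Lipschitz map from
`L²(0,∞; X) ∩ H¹(0,∞; X')` to `L²(0,∞; Z)`. -/
theorem SobolevTime.exists_quadratic_map (hι : ∀ x x', ι x x' = ⟪T x, T x'⟫)
    (B : H →L[ℝ] H →L[ℝ] Z) {c : ℝ → ℝ} (hc : Continuous c)
    (hc1 : ∀ t, 0 < t → |c t| ≤ 1) :
    ∃ Q : SobolevTime ι → Lp Z 2 timeMeasure,
      (∀ p, ∀ᵐ t ∂timeMeasure, Q p t = c t • B (T (p.1.fst t)) (T (p.1.fst t))) ∧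
      ∃ C : ℝ, 0 < C ∧ ∀ p q, ‖Q p - Q q‖ ≤ C * (‖p‖ + ‖q‖) * ‖p - q‖ := by
  set K := √(‖T‖ ^ 2 + 1)
  have hpos : ∀ᵐ t ∂timeMeasure, 0 < t := ae_restrict_mem measurableSet_Ioi
  have hmem : ∀ p : SobolevTime ι,
      MemLp (fun t => c t • B (T (p.1.fst t)) (T (p.1.fst t))) 2 timeMeasure := by
    intro p
    have hT : MemLp (fun t => T (p.1.fst t)) 2 timeMeasure := T.comp_memLp' (Lp.memLp p.1.fst)
    have hmeas : AEStronglyMeasurable (fun t => B (T (p.1.fst t)) (T (p.1.fst t))) timeMeasure :=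
      B.aestronglyMeasurable_comp₂ hT.1 hT.1
    -- One factor is bounded uniformly in time by the embedding, the other is kept in `L²` in time.
    refine hT.of_le_mul (c := ‖B‖ * (K * ‖p‖)) (hc.aestronglyMeasurable.smul hmeas) ?_
    filter_upwards [SobolevTime.ae_norm_le hι p, hpos] with t ht h0
    rw [norm_smul, Real.norm_eq_abs]
    calc |c t| * ‖B (T (p.1.fst t)) (T (p.1.fst t))‖
        ≤ 1 * (‖B‖ * ‖T (p.1.fst t)‖ * ‖T (p.1.fst t)‖) := by
          gcongr
          · exact hc1 t h0
          · exact B.le_opNorm₂ _ _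
      _ ≤ ‖B‖ * (K * ‖p‖) * ‖T (p.1.fst t)‖ := by
          rw [one_mul]
          gcongr
  -- The `+ 1` only keeps the constant positive when `B` or `T` vanishes.
  refine ⟨fun p => (hmem p).toLp _, fun p => (hmem p).coeFn_toLp, ‖B‖ * K * ‖T‖ + 1,
    by positivity, fun p q => ?_⟩
  have h1 : ‖(hmem p).toLp _ - (hmem q).toLp _‖
      ≤ ‖B‖ * (K * ‖p‖ + K * ‖q‖) * ‖T‖ * ‖p.1.fst - q.1.fst‖ := by
    refine Lp.norm_le_mul_norm_of_ae_le_mul ?_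
    filter_upwards [SobolevTime.ae_norm_le hι p, SobolevTime.ae_norm_le hι q, hpos,
      Lp.coeFn_sub ((hmem p).toLp _) ((hmem q).toLp _), (hmem p).coeFn_toLp, (hmem q).coeFn_toLp,
      Lp.coeFn_sub p.1.fst q.1.fst] with t htp htq h0 e1 e2 e3 e4
    rw [e1, e4, Pi.sub_apply, Pi.sub_apply, e2, e3, ← smul_sub, norm_smul, Real.norm_eq_abs]
    calc |c t| * ‖B (T (p.1.fst t)) (T (p.1.fst t)) - B (T (q.1.fst t)) (T (q.1.fst t))‖
        ≤ 1 * (‖B‖ * (‖T (p.1.fst t)‖ + ‖T (q.1.fst t)‖) * ‖T (p.1.fst t) - T (q.1.fst t)‖) := by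
          gcongr
          · exact hc1 t h0
          · exact norm_bilin_self_sub_le B _ _
      _ ≤ 1 * (‖B‖ * (K * ‖p‖ + K * ‖q‖) * (‖T‖ * ‖p.1.fst t - q.1.fst t‖)) := by
          gcongr
          rw [← map_sub]
          exact T.le_opNorm _
      _ = _ := by ring
  have h2 : ‖p.1.fst - q.1.fst‖ ≤ ‖p - q‖ := by
    have e : ‖p - q‖ ^ 2 = ‖(p - q).1.fst‖ ^ 2 + ‖(p - q).1.snd‖ ^ 2 :=
      WithLp.prod_norm_sq_eq_of_L2 (p - q).1
    refine abs_le_of_sq_le_sq' (a := ‖p.1.fst - q.1.fst‖) ?_ (norm_nonneg _) |>.2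
    rw [e]
    exact le_add_of_nonneg_right (by positivity)
  calc ‖(hmem p).toLp _ - (hmem q).toLp _‖
      ≤ ‖B‖ * (K * ‖p‖ + K * ‖q‖) * ‖T‖ * ‖p.1.fst - q.1.fst‖ := h1
    _ ≤ ‖B‖ * (K * ‖p‖ + K * ‖q‖) * ‖T‖ * ‖p - q‖ := by gcongr
    _ = ‖B‖ * K * ‖T‖ * (‖p‖ + ‖q‖) * ‖p - q‖ := by ring
    _ ≤ (‖B‖ * K * ‖T‖ + 1) * (‖p‖ + ‖q‖) * ‖p - q‖ := by gcongr; linarith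

end Quadratic

/-! ### The remainder as a bounded bilinear form -/

section Remainder

variable {d : ℕ}

/-! ### Multiplication operators and convolution operators on `L²` -/

lemma memLp_top_of_continuous {m : Torus d → ℝ} (hm : Continuous m) : MemLp m ∞ := by
  obtain ⟨C, hC⟩ := exists_abs_le_of_continuous hm
  exact memLp_top_of_bound hm.aestronglyMeasurable C (ae_of_all _ hC)

/-- Multiplication of functions in `L^∞(Ω)` and `L²(Ω)`. -/
def mulL (d : ℕ) : Lp ℝ ∞ (volume : Measure (Torus d)) →L[ℝ] L2 d →L[ℝ] L2 d :=
  (ContinuousLinearMap.mul ℝ ℝ).holderL volume ∞ 2 2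

lemma coeFn_mulL (g : Lp ℝ ∞ (volume : Measure (Torus d))) (f : L2 d) :
    ∀ᵐ x, mulL d g f x = g x * f x :=
  (ContinuousLinearMap.mul ℝ ℝ).coeFn_holder g f

/-- Multiplication by a continuous function on `L²(Ω)`. -/
def mulContinuous {m : Torus d → ℝ} (hm : Continuous m) : L2 d →L[ℝ] L2 d :=
  mulL d ((memLp_top_of_continuous hm).toLp m)

lemma coeFn_mulContinuous {m : Torus d → ℝ} (hm : Continuous m) (f : L2 d) :
    ∀ᵐ x, mulContinuous hm f x = m x * f x := by
  filter_upwards [coeFn_mulL ((memLp_top_of_continuous hm).toLp m) f,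
    (memLp_top_of_continuous hm).coeFn_toLp] with x h1 h2
  rw [mulContinuous, h1, h2]

lemma integrable_L2 (f : L2 d) : Integrable (f : Torus d → ℝ) :=
  (Lp.memLp f).integrable (by norm_num)

lemma exists_integral_abs_le (d : ℕ) : ∃ c : ℝ, 0 ≤ c ∧ ∀ f : L2 d, ∫ x, |f x| ≤ c * ‖f‖ := by
  refine ⟨((volume : Measure (Torus d)) univ ^ (1 / (1 : ℝ≥0∞).toReal - 1 / (2 : ℝ≥0∞).toReal)).toReal,
    ENNReal.toReal_nonneg, fun f => ?_⟩
  have h := eLpNorm_le_eLpNorm_mul_rpow_measure_univ (μ := (volume : Measure (Torus d)))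
    (p := 1) (q := 2) (by norm_num) (Lp.memLp f).1
  have hfin : eLpNorm f 2 volume *
      (volume : Measure (Torus d)) univ ^ (1 / (1 : ℝ≥0∞).toReal - 1 / (2 : ℝ≥0∞).toReal) ≠ ∞ :=
    ENNReal.mul_ne_top (Lp.memLp f).2.ne
      (ENNReal.rpow_ne_top_of_nonneg (by norm_num) (measure_ne_top _ _))
  have h2 := ENNReal.toReal_mono hfin h
  rw [ENNReal.toReal_mul, eLpNorm_one_eq_lintegral_enorm,
    ← integral_norm_eq_lintegral_enorm (Lp.memLp f).1] at h2
  exact h2.trans_eq (mul_comm _ _)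

lemma conv_congr_ae {k u v : Torus d → ℝ} (h : u =ᵐ[volume] v) : conv k u = conv k v := by
  funext x
  refine integral_congr_ae ?_
  filter_upwards [h] with z hz
  rw [hz]

/-- Convolution with a bounded kernel, as an operator from `L²(Ω)` to `L^∞(Ω)`. -/
lemma exists_convL {k : Torus d → ℝ} (hk : MemLp k ∞) :
    ∃ A : L2 d →L[ℝ] Lp ℝ ∞ (volume : Measure (Torus d)), ∀ u : L2 d, ∀ᵐ x, A u x = conv k u x := by
  obtain ⟨K, hK0, hK⟩ := ae_norm_le_of_memLp_top hk
  obtain ⟨c, hc0, hc⟩ := exists_integral_abs_le d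
  have hmem : ∀ u : L2 d, MemLp (conv k u) ∞ (volume : Measure (Torus d)) := fun u =>
    memLp_top_of_continuous (continuous_conv hk (integrable_L2 u))
  let A : L2 d →ₗ[ℝ] Lp ℝ ∞ (volume : Measure (Torus d)) :=
    { toFun := fun u => (hmem u).toLp _
      map_add' := fun u v => by
        rw [← MemLp.toLp_add, MemLp.toLp_eq_toLp_iff, conv_congr_ae (Lp.coeFn_add u v)]
        refine ae_of_all _ fun x => ?_
        simp only [conv, Pi.add_apply, mul_add]
        exact integral_add (integrable_conv hk (integrable_L2 u) x)
          (integrable_conv hk (integrable_L2 v) x)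
      map_smul' := fun a u => by
        rw [RingHom.id_apply, ← MemLp.toLp_const_smul, MemLp.toLp_eq_toLp_iff,
          conv_congr_ae (Lp.coeFn_smul a u)]
        refine ae_of_all _ fun x => ?_
        simp only [conv, Pi.smul_apply, smul_eq_mul, mul_left_comm _ a]
        exact integral_const_mul _ _ }
  refine ⟨A.mkContinuous (K * c) fun u => ?_, fun u => (hmem u).coeFn_toLp⟩
  have h : ∀ᵐ x, ‖(A u : Torus d → ℝ) x‖ ≤ K * c * ‖u‖ := by
    filter_upwards [(hmem u).coeFn_toLp] with x hx
    change ‖((hmem u).toLp _ : Torus d → ℝ) x‖ ≤ _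
    rw [hx, Real.norm_eq_abs, mul_assoc]
    exact (abs_conv_le hK (integrable_L2 u) x).trans (mul_le_mul_of_nonneg_left (hc u) hK0)
  simpa using Lp.norm_le_of_ae_bound (by positivity) h

/-! ### Multiplication by `C¹` functions on `H¹` -/

/-- The weak partial derivative as an operator from `H¹(Ω)` to `L²(Ω)`. -/
def partialL (i : Fin d) : H1 d →L[ℝ] L2 d :=
  (PiLp.proj 2 (fun _ : Fin d => L2 d) i).comp
    ((WithLp.sndL 2 ℝ (L2 d) (PiLp 2 (fun _ : Fin d => L2 d))).comp (h1Submodule d).subtypeL)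

/-- The operator `φ ↦ ∂ᵢ (m φ)` from `H¹(Ω)` to `L²(Ω)` for a `C¹` function `m`. -/
def partialMul {m : Torus d → ℝ} {Dm : Fin d → Torus d → ℝ} (hm : HasC1Grad m Dm) (i : Fin d) :
    H1 d →L[ℝ] L2 d :=
  (mulContinuous hm.continuous).comp (partialL i)
    + (mulContinuous (hm.continuous_grad i)).comp (H1.toL2 d)

/-- `H¹(Ω)` is stable under multiplication by `C¹` functions. -/
lemma HasC1Grad.exists_mul {m : Torus d → ℝ} {Dm : Fin d → Torus d → ℝ} (hm : HasC1Grad m Dm)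
    (φ : H1 d) : ∃ χ : H1 d, (∀ᵐ x, H1.toL2 d χ x = m x * H1.toL2 d φ x) ∧
      ∀ i, H1.partial i χ = partialMul hm i φ := by
  refine ⟨⟨WithLp.toLp 2 (mulContinuous hm.continuous (H1.toL2 d φ),
    WithLp.toLp 2 fun i => partialMul hm i φ), ?_⟩, coeFn_mulContinuous hm.continuous _, fun i => rfl⟩
  intro i ψ Dψ hψ
  -- Testing `φ` against `m ψ` and moving the term with `∂ᵢ m` to the other side gives the product
  -- rule for `m φ`.
  have hweak := φ.2 i _ _ (hm.mul hψ)
  have i1 := integrable_mul_continuous (φ := fun x => Dm i x * ψ x)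
    ((hm.continuous_grad i).mul hψ.continuous) (H1.toL2 d φ)
  have i2 := integrable_mul_continuous (φ := fun x => m x * Dψ i x)
    (hm.continuous.mul (hψ.continuous_grad i)) (H1.toL2 d φ)
  have i3 := integrable_mul_continuous (φ := fun x => m x * ψ x)
    (hm.continuous.mul hψ.continuous) (partialL i φ)
  have e1 : ∫ x, mulContinuous hm.continuous (H1.toL2 d φ) x * Dψ i x
      = ∫ x, H1.toL2 d φ x * (m x * Dψ i x) := by
    refine integral_congr_ae ?_
    filter_upwards [coeFn_mulContinuous hm.continuous (H1.toL2 d φ)] with x hx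
    rw [hx]; ring
  have e2 : ∫ x, partialMul hm i φ x * ψ x
      = ∫ x, (partialL i φ x * (m x * ψ x) + H1.toL2 d φ x * (Dm i x * ψ x)) := by
    refine integral_congr_ae ?_
    filter_upwards [coeFn_mulContinuous hm.continuous (partialL i φ),
      coeFn_mulContinuous (hm.continuous_grad i) (H1.toL2 d φ),
      Lp.coeFn_add (mulContinuous hm.continuous (partialL i φ))
        (mulContinuous (hm.continuous_grad i) (H1.toL2 d φ))] with x h1 h2 h3
    change (mulContinuous hm.continuous (partialL i φ)
        + mulContinuous (hm.continuous_grad i) (H1.toL2 d φ) : L2 d) x * ψ x = _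
    rw [h3, Pi.add_apply, h1, h2]; ring
  have hw2 : ∫ x, (H1.toL2 d φ x * (Dm i x * ψ x) + H1.toL2 d φ x * (m x * Dψ i x))
      = -∫ x, partialL i φ x * (m x * ψ x) := by
    simp only [← mul_add]
    exact hweak
  rw [integral_add i1 i2] at hw2
  change ∫ x, mulContinuous hm.continuous (H1.toL2 d φ) x * Dψ i x
    = -∫ x, partialMul hm i φ x * ψ x
  rw [e1, e2, integral_add i3 i1]
  linarith

/-! ### The bilinear form of the remainder -/

lemma exists_neg_sum_bilin {κ E F G : Type*} [Fintype κ] [NormedAddCommGroup E] [NormedSpace ℝ E]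
    [NormedAddCommGroup F] [NormedSpace ℝ F] [NormedAddCommGroup G] [NormedSpace ℝ G]
    (B : κ → E →L[ℝ] F →L[ℝ] G) :
    ∃ B' : E →L[ℝ] F →L[ℝ] G, ∀ v u, B' v u = -∑ i, B i v u :=
  ⟨-∑ i, B i, fun v u => by simp⟩

/-- The bilinear operator `(v, u) ↦ (φ ↦ -∫ s u (k * (s v)) · ∇(m φ))`. -/
lemma exists_bilin {k : Fin d → Torus d → ℝ} (hk : ∀ i, MemLp (k i) ∞) {s : Torus d → ℝ}
    (hs : Continuous s) {m : Torus d → ℝ} {Dm : Fin d → Torus d → ℝ} (hm : HasC1Grad m Dm) :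
    ∃ B : L2 d →L[ℝ] L2 d →L[ℝ] H1Dual d, ∀ v u φ, B v u φ
      = -∫ x, ∑ i, s x * u x * conv (k i) (fun x => s x * v x) x * partialMul hm i φ x := by
  choose A hA using fun i => exists_convL (hk i)
  let S : L2 d →L[ℝ] L2 d := mulContinuous hs
  -- `P i f` is the functional `φ ↦ ⟪f, ∂ᵢ(m φ)⟫`.
  let P : Fin d → L2 d →L[ℝ] H1Dual d := fun i =>
    (ContinuousLinearMap.precomp ℝ (partialMul hm i)).comp (innerSL ℝ)
  obtain ⟨B, hB⟩ := exists_neg_sum_bilin fun i =>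
    (ContinuousLinearMap.compL ℝ (L2 d) (L2 d) (H1Dual d) (P i)).comp
      (((ContinuousLinearMap.compL ℝ (L2 d) (L2 d) (L2 d)).flip S).comp
        ((mulL d).comp ((A i).comp S)))
  refine ⟨B, fun v u φ => ?_⟩
  have e : ∀ i, ⟪mulL d (A i (S v)) (S u), partialMul hm i φ⟫
      = ∫ x, s x * u x * conv (k i) (fun x => s x * v x) x * partialMul hm i φ x ∧
      Integrable (fun x =>
        s x * u x * conv (k i) (fun x => s x * v x) x * partialMul hm i φ x) := by
    intro i
    have hae : (fun x => ⟪mulL d (A i (S v)) (S u) x, partialMul hm i φ x⟫) =ᵐ[volume] fun x =>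
        s x * u x * conv (k i) (fun x => s x * v x) x * partialMul hm i φ x := by
      filter_upwards [coeFn_mulL (A i (S v)) (S u), hA i (S v), coeFn_mulContinuous hs u]
        with x h1 h2 h3
      rw [h1, h2, h3, conv_congr_ae (coeFn_mulContinuous hs v)]
      simp only [RCLike.inner_apply, conj_trivial]
      ring
    exact ⟨by rw [L2.inner_def]; exact integral_congr_ae hae, (L2.integrable_inner _ _).congr hae⟩
  rw [integral_finsetSum _ fun i _ => (e i).2]
  simp only [← (e _).1]
  rw [hB, _root_.neg_apply, _root_.sum_apply]
  rfl

/-! ### The square root of a stationary state -/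

lemma HasC1Grad.exp_conv_potential {V W : Torus d → ℝ} {DV DW : Fin d → Torus d → ℝ}
    (hV : HasC1Grad V DV) (hW : HasGradW1Infty W DW) {μ : Torus d → ℝ} (hμ : Integrable μ)
    (a b : ℝ) :
    HasC1Grad (fun x => a * Real.exp (b * meanFieldPotential V W μ x)) (fun i x =>
      a * (Real.exp (b * meanFieldPotential V W μ x) * b) * (DV i x + conv (DW i) μ x)) :=
  (hV.add (hW.hasC1Grad_conv hμ)).of_comp (g := fun r => a * Real.exp (b * r))
    (g' := fun r => a * (Real.exp (b * r) * b))
    (fun r => by simpa using (((hasDerivAt_id r).const_mul b).exp.const_mul a)) (by fun_prop)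

/-- The density is known only almost everywhere; the witnesses `Z^{∓1/2} exp(∓(V + W * μ)/(2σ))` are
regular representatives of `√μ` and its inverse. -/
lemma IsStationaryState.exists_sqrt {σ : ℝ} {V W μ : Torus d → ℝ}
    {DV DW : Fin d → Torus d → ℝ} (hV : HasC1Grad V DV) (hW : HasGradW1Infty W DW)
    (hμ : IsStationaryState σ V W μ) :
    ∃ (s m : Torus d → ℝ) (Dm : Fin d → Torus d → ℝ), Continuous s ∧ HasC1Grad m Dm ∧
      (∀ᵐ x, √(μ x) = s x) ∧ ∀ᵐ x, m x = (√(μ x))⁻¹ := by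
  set Z := ∫ x', Real.exp (-(meanFieldPotential V W μ x') / σ)
  -- If `Z` were `0`, then `Z⁻¹ = 0` by convention, so `μ` would vanish almost everywhere, against
  -- total mass one.
  have hZ : 0 < Z := by
    refine lt_of_le_of_ne (integral_nonneg fun x => (Real.exp_pos _).le) fun h0 => ?_
    have h1 := hμ.integral_eq_one
    rw [integral_congr_ae hμ.self_consistent] at h1
    change ∫ x, Z⁻¹ * _ = _ at h1
    rw [← h0] at h1
    simp at h1
  have hs := (hV.exp_conv_potential hW hμ.integrable (√Z)⁻¹ (-(1 / (2 * σ)))).continuous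
  have hm := hV.exp_conv_potential hW hμ.integrable (√Z) (1 / (2 * σ))
  have key : ∀ᵐ x, √(μ x) = (√Z)⁻¹ * Real.exp (-(1 / (2 * σ)) * meanFieldPotential V W μ x) := by
    filter_upwards [hμ.self_consistent] with x hx
    rw [hx, Real.sqrt_mul (inv_nonneg.2 hZ.le), Real.sqrt_inv, ← Real.exp_half]
    congr 2
    field_simp
  refine ⟨_, _, _, hs, hm, key, ?_⟩
  filter_upwards [key] with x hx
  rw [hx, mul_inv, inv_inv, ← Real.exp_neg, neg_mul, neg_neg]

lemma pivot_apply (w : L2 d) (x x' : H10 w) :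
    pivot w x x' = ⟪H10.toL2 w x, H10.toL2 w x'⟫ := rfl

end Remainder

end McKeanVlasov

end

open MeasureTheory McKeanVlasov
/-- The nonlinear remainder `Ŵ^δ(y) = e^{-2δt} 𝒰 𝒲(𝒰⁻¹ y)` maps `W(Q_∞)` to `L²(0,∞; [H¹(Ω)]')` and is
locally Lipschitz. The condition defining `L²₀(Ω)` may be `∫ y = 0` or `∫ √μ̄ y = 0`. -/
theorem mainTheorem8 (d : ℕ) (σ δ : ℝ) (hσ : 0 < σ) (hδ : 0 < δ)
    (V W : Torus d → ℝ) (DW : Fin d → Torus d → ℝ)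
    (hV : IsC2 V) (hW : HasGradW2Infty W DW) (hW_even : ∀ᵐ x, W (-x) = W x)
    (μbar : Torus d → ℝ) (hμ : IsStationaryState σ V W μbar)
    (w : L2 d) (hw : (∀ᵐ x, w x = 1) ∨ (∀ᵐ x, w x = √(μbar x))) :
    ∃ What : EvolutionSpace w → Lp (H1Dual d) 2 timeMeasure,
      (∀ y : EvolutionSpace w, IsTransformedRemainder δ DW μbar y (What y)) ∧
      ∃ C : ℝ, 0 < C ∧ ∀ y z : EvolutionSpace w,
        ‖What y - What z‖ ≤ C * (‖y‖ + ‖z‖) * ‖y - z‖ := by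
  obtain ⟨DV, hDV, -⟩ := hV
  obtain ⟨s, m, Dm, hs, hm, hsμ, hmμ⟩ := hμ.exists_sqrt hDV hW.first
  obtain ⟨B, hB⟩ := exists_bilin hW.first.memLp_grad hs hm
  obtain ⟨Q, hQ, hC⟩ := SobolevTime.exists_quadratic_map (pivot_apply w) B
    (c := fun t => Real.exp (-2 * δ * t)) (by fun_prop) fun t ht => by
      rw [abs_of_pos (Real.exp_pos _), Real.exp_le_one_iff]
      nlinarith [mul_pos hδ ht]
  refine ⟨Q, fun y => ?_, hC⟩
  filter_upwards [hQ y] with t ht φ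
  -- `χ = m φ` is the representative in `H¹` of `φ / √μ̄`.
  obtain ⟨χ, hχ, hDχ⟩ := hm.exists_mul φ
  refine ⟨χ, ?_, ?_⟩
  · filter_upwards [hχ, hmμ] with x h1 h2
    rw [h1, h2, div_eq_inv_mul]
  · have hu : (fun x => √(μbar x) * EvolutionSpace.value y t x) =ᵐ[volume]
        fun x => s x * EvolutionSpace.value y t x := by
      filter_upwards [hsμ] with x hx
      rw [hx]
    rw [ht]
    -- Inside the convolution, exchanging `√μ̄` for `s` gives equality at every point; the outer
    -- factor agrees only almost everywhere and is treated under the integral.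
    simp only [_root_.smul_apply, hB, smul_eq_mul, nonlocalOperator, divergence, hDχ,
      conv_congr_ae hu]
    congr 2
    refine integral_congr_ae ?_
    filter_upwards [hsμ] with x hx
    rw [hx]
    rfl
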